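/- **Theorem 4.2.** Let $p\ge 1$ and consider the multiple chirp model $$y(t)=\sum_{k=1}^p\Bigl(A_k^0\cos(\theta_{1k}^0t+\theta_{2k}^0t^2)+B_k^0\sin(\theta_{1k}^0t+\theta_{2k}^0t^2)\Bigr)+e(t),\qquad t=1,2,\dots,$$ where $e(1),e(2),\dots$ are i.i.d. real random variables with mean zero and $E|e(t)|^{1+\delta}<\infty$ for some $0<\delta<1$. Write $\boldsymbol\theta_k^0=(\theta_{1k}^0,\theta_{2k}^0)$ and $\boldsymbol\eta_k^0=(A_k^0,B_k^0,\theta_{1k}^0,\theta_{2k}^0)$. Assume: 1. (Parameter space.) $\Theta\subseteq(0,\pi)\times(0,\pi)$ is identifiable: it does not contain two different points of the form $(\theta_1,\theta_2)$ and $(\pi-\theta_1,\pi-\theta_2)$. (Since $t+t^2$ is even, $(A,B,\theta_1,\theta_2)$ and $(A,-B,\pi-\theta_1,\pi-\theta_2)$ give the same chirp.) Each $\boldsymbol\theta_k^0$ is an interior point of $\Theta$; the amplitudes range over $\mathbb R^2$. 2. (Distinct, nonresonant frequencies.) None of the pairs $\boldsymbol\theta_j^0+\boldsymbol\theta_k^0$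 (all $j,k$, including $j=k$) and $\boldsymbol\theta_j^0-\boldsymbol\theta_k^0$ ($j\ne k$) lies in the countable set $(\pi\mathbb Q)\times(\pi\mathbb Q)$; in particular the $\boldsymbol\theta_k^0$ are distinct. 3. (Ordered amplitudes.) $\infty>(A_1^0)^2+(B_1^0)^2>\cdots>(A_p^0)^2+(B_p^0)^2>0$. For a sequence $z(1),\dots,z(n)$ put $$I_{n,z}(\theta_1,\theta_2)=\frac2n\Bigl|\sum_{t=1}^nz(t)e^{-i(\theta_1t+\theta_2t^2)}\Bigr|^2 .$$ The approximate least squares estimators (ALSEs) $\widetilde{\boldsymbol\eta}_k=(\widetilde A_k,\widetilde B_k,\widetilde\theta_{1k},\widetilde\theta_{2k})$ from a sample of size $n$ are computed one after another, $k=1,\dots,p$: $\widetilde{\boldsymbol\theta}_k=(\widetilde\theta_{1k},\widetilde\theta_{2k})$ is a maximizer of a periodogram as specified below, and $$\widetilde A_k=\frac2n\sum_{t=1}^ny(t)\cos(\widetilde\theta_{1k}t+\widetilde\theta_{2k}t^2),\qquad \widetilde B_k=\frac2n\sum_{t=1}^ny(t)\sin(\widetilde\theta_{1k}t+\widetilde\theta_{2k}t^2).$$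 * (a) Sequential maximization over $\Theta$: $\widetilde{\boldsymbol\theta}_k$ maximizes $I_{n,y_k}$ over $\Theta$, where $y_k(t)=y(t)-\sum_{j<k}\bigl(\widetilde A_j\cos(\widetilde\theta_{1j}t+\widetilde\theta_{2j}t^2)+\widetilde B_j\sin(\widetilde\theta_{1j}t+\widetilde\theta_{2j}t^2)\bigr)$; in particular $y_1=y$. * (b) Local maximization: $\widetilde{\boldsymbol\theta}_k$ maximizes $I_{n,y}$ over a search region $N_k\subseteq\Theta$ that is a neighbourhood of $\boldsymbol\theta_k^0$. The first region $N_1$ is arbitrary (for example $N_1=\Theta$), and for $k\ge2$ the region $N_k$ is contained in the ball of radius $r$ about $\boldsymbol\theta_k^0$. Then the ALSEs of (a) are strongly consistent, and there is $r>0$ such that the ALSEs of (b) are strongly consistent for all such search regions $N_1,\dots,N_p$. That is, for any choice of maximizers (required only almost surely for all sufficiently large $n$), $\widetilde{\boldsymbol\eta}_j\to\boldsymbol\eta_j^0$ almost surely as $n\to\infty$, for every $j=1,\dots,p$. -/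

import Mathlib

open MeasureTheory ProbabilityTheory Filter Topology

noncomputable section

/-- The parameter `((A, B), (θ₁, θ₂))` of one chirp component: amplitudes, then frequency and
frequency rate. -/
abbrev ChirpParam : Type := (ℝ × ℝ) × (ℝ × ℝ)

/-- The phase `θ₁ t + θ₂ t²`. -/
def chirpPhase (θ : ℝ × ℝ) (t : ℕ) : ℝ := θ.1 * t + θ.2 * (t : ℝ) ^ 2

/-- One component `A cos(θ₁ t + θ₂ t²) + B sin(θ₁ t + θ₂ t²)`. -/
def chirp (η : ChirpParam) (t : ℕ) : ℝ :=
  η.1.1 * Real.cos (chirpPhase η.2 t) + η.1.2 * Real.sin (chirpPhase η.2 t)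

/-- The squared amplitude `A² + B²` of a component. -/
def chirpPower (η : ChirpParam) : ℝ := η.1.1 ^ 2 + η.1.2 ^ 2

/-- The observations `y(t) = ∑ₖ (Aₖ cos(θ₁ₖ t + θ₂ₖ t²) + Bₖ sin(θ₁ₖ t + θ₂ₖ t²)) + e(t)`. -/
def chirpData {Ω : Type*} {p : ℕ} (η : Fin p → ChirpParam) (e : ℕ → Ω → ℝ) (ω : Ω) (t : ℕ) : ℝ :=
  ∑ k, chirp (η k) t + e t ω

/-- The errors `e(1), e(2), …` are i.i.d. with mean zero and `E|e(t)|^(1+δ) < ∞`, `0 < δ < 1`.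
The value of `e` at time `0` plays no role. -/
structure IsErrorProcess {Ω : Type*} [MeasurableSpace Ω] (P : Measure Ω) (δ : ℝ)
    (e : ℕ → Ω → ℝ) : Prop where
  delta_pos : 0 < δ
  delta_lt_one : δ < 1
  indep : iIndepFun (fun t : ℕ => e (t + 1)) P
  ident : ∀ t : ℕ, 1 ≤ t → IdentDistrib (e t) (e 1) P P
  moment : Integrable (fun ω => |e 1 ω| ^ (1 + δ)) P
  mean_zero : ∫ ω, e 1 ω ∂P = 0

/-- Reflection `(θ₁, θ₂) ↦ (π - θ₁, π - θ₂)`.  Since `t + t²` is even, the phase at the reflected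
point is the negative of the phase at `θ` modulo `2π` for every integer `t`, so that
`(A, B, θ)` and `(A, -B, π - θ)` are the same chirp. -/
def chirpReflect (θ : ℝ × ℝ) : ℝ × ℝ := (Real.pi - θ.1, Real.pi - θ.2)

/-- A parameter space for (frequency, frequency rate): a subset of `(0, π) × (0, π)` that does not
contain two different points related by the reflection, that is, on which the chirps are
identifiable. -/
structure IsFrequencySpace (Θ : Set (ℝ × ℝ)) : Prop where
  subset : Θ ⊆ Set.Ioo 0 Real.pi ×ˢ Set.Ioo 0 Real.pi
  identifiable : ∀ θ ∈ Θ, chirpReflect θ ∈ Θ → chirpReflect θ = θ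

/-- The countable exceptional set of pairs whose coordinates are both rational multiples
of `π`; off this set the averages of `exp(i(θ₁ t + θ₂ t²))` tend to zero. -/
def IsExceptional (θ : ℝ × ℝ) : Prop :=
  ∃ a b : ℚ, θ = ((a : ℝ) * Real.pi, (b : ℝ) * Real.pi)

/-- The frequencies are nonresonant: no sum `θⱼ + θₖ` (including `2 θₖ`) and no difference
`θⱼ - θₖ` with `j ≠ k` is exceptional.  In particular the pairs `θₖ` are distinct and none of
them is exceptional. -/
structure IsNonresonant {p : ℕ} (θ : Fin p → ℝ × ℝ) : Prop where
  add : ∀ j k, ¬ IsExceptional (θ j + θ k)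
  sub : ∀ j k, j ≠ k → ¬ IsExceptional (θ j - θ k)

/-- The periodogram-like function `I(θ) = (2/n) |∑_{t=1}^n y(t) exp(-i(θ₁ t + θ₂ t²))|²`. -/
def periodogram (n : ℕ) (y : ℕ → ℝ) (θ : ℝ × ℝ) : ℝ :=
  2 / (n : ℝ) *
    ‖∑ t ∈ Finset.Icc 1 n, (y t : ℂ) * Complex.exp (-(Complex.I * (chirpPhase θ t : ℂ)))‖ ^ 2

/-- The amplitude estimates `(2/n) ∑ y(t) cos(θ₁ t + θ₂ t²)`, `(2/n) ∑ y(t) sin(θ₁ t + θ₂ t²)`. -/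
def amplitudeEstimate (n : ℕ) (y : ℕ → ℝ) (θ : ℝ × ℝ) : ℝ × ℝ :=
  (2 / (n : ℝ) * ∑ t ∈ Finset.Icc 1 n, y t * Real.cos (chirpPhase θ t),
   2 / (n : ℝ) * ∑ t ∈ Finset.Icc 1 n, y t * Real.sin (chirpPhase θ t))

/-- The data left after the components estimated before step `k` have been removed. -/
def chirpResidual {p : ℕ} (y : ℕ → ℝ) (η : Fin p → ChirpParam) (k : Fin p) (t : ℕ) : ℝ :=
  y t - ∑ j ∈ Finset.Iio k, chirp (η j) t

/-- `η` is a family of ALSEs from `y(1), …, y(n)`, computed one after another: the frequency pair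
of step `k` maximizes over `Θ` the periodogram of the data left from the earlier steps
(of `y` itself at the first step), and the amplitudes are the estimates at that pair. -/
def IsSequentialALSE {p : ℕ} (Θ : Set (ℝ × ℝ)) (n : ℕ) (y : ℕ → ℝ)
    (η : Fin p → ChirpParam) : Prop :=
  ∀ k, (η k).2 ∈ Θ ∧ IsMaxOn (periodogram n (chirpResidual y η k)) Θ (η k).2 ∧
    (η k).1 = amplitudeEstimate n y (η k).2

/-- `η` is a family of ALSEs from `y(1), …, y(n)`, computed one after another by local search:
the frequency pair of step `k` maximizes the periodogram of `y` over the search region `N k`, and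
the amplitudes are the estimates at that pair. -/
def IsLocalALSE {p : ℕ} (N : Fin p → Set (ℝ × ℝ)) (n : ℕ) (y : ℕ → ℝ)
    (η : Fin p → ChirpParam) : Prop :=
  ∀ k, (η k).2 ∈ N k ∧ IsMaxOn (periodogram n y) (N k) (η k).2 ∧
    (η k).1 = amplitudeEstimate n y (η k).2

/-- Strong consistency of the estimators `ηn` (`n` the sample size) for `η₀`: almost sure
convergence of all four coordinates. -/
def IsStronglyConsistent {Ω : Type*} [MeasurableSpace Ω] (P : Measure Ω)
    (ηn : ℕ → Ω → ChirpParam) (η₀ : ChirpParam) : Prop :=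
  ∀ᵐ ω ∂P, Tendsto (fun n => ηn n ω) atTop (𝓝 η₀)

end

/-! Write each real chirp as two complex chirps with frequency pairs `θₖ` and `-θₖ` and conjugate
coefficients of modulus `√(Aₖ² + Bₖ²) / 2`. Maximizing the periodogram means maximizing the modulus
of `demod`, which at `θ` equals the sum of the coefficients times `chirpMean n (F a - θ)`, plus a
noise term. The proof rests on three estimates that are uniform in `θ`.

Weyl differencing (`exists_rational_approx_of_le_norm_chirpMean`): a mean of modulus at least `ε`
forces both frequencies to within `C / n` of rational multiples of `π` with bounded common
denominator. If two components were visible at the same `θ`, eliminating `θ` would place a bounded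
multiple of their frequency difference near `(π ℤ)²`, which nonresonance forbids
(`eventually_norm_chirpMean_le_or`). Hence at most one component contributes at any `θ`, even when
`θ` varies with `n`.

Rigidity (`exists_abs_sub_mul_pi_le_of_norm_chirpMean`): a mean of modulus near one forces the
frequencies to within `o(1/n)` and `o(1/n²)` of multiples of `π`; inside `(0, π)²` this multiple is
zero.

Noise (`IsErrorProcess.ae_isNegligibleOn`): the noise term tends to zero uniformly, by truncation,
Hoeffding's inequality on a polynomially large grid, and the strong law for the truncated tails.

At a maximizer the modulus is asymptotically at least that at the true pair, which tends to the
modulus of the dominating coefficient. No other component can supply it: it has a smaller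
coefficient, or the search region is too far from it, or, for the conjugate of the component itself,
identifiability keeps its mean away from modulus one. So the mean of the true component tends to
modulus one, and rigidity gives `chirpDist → 0`. This rate yields the amplitudes, and makes the
error of removing an estimated component uniformly negligible, so that the sequential procedure can
be treated by induction. -/

/-! ### The unit complex number of a given argument -/

/-- The unit complex number `exp(i x)`. -/
noncomputable def cis (x : ℝ) : ℂ := Complex.exp (Complex.I * (x : ℂ))

theorem norm_cis (x : ℝ) : ‖cis x‖ = 1 := Complex.norm_exp_I_mul_ofReal x

theorem cis_zero : cis 0 = 1 := by simp [cis]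

theorem cis_add (x y : ℝ) : cis (x + y) = cis x * cis y := by
  simp [cis, mul_add, Complex.exp_add]

theorem cis_neg (x : ℝ) : cis (-x) = (starRingEnd ℂ) (cis x) := by
  simp [cis, ← Complex.exp_conj]

theorem cis_eq_cos_add_sin (x : ℝ) : cis x = Real.cos x + Real.sin x * Complex.I := by
  simp [cis, mul_comm Complex.I, Complex.exp_mul_I]

theorem cis_re (x : ℝ) : (cis x).re = Real.cos x := by
  rw [cis, mul_comm, Complex.exp_ofReal_mul_I_re]

theorem cis_im (x : ℝ) : (cis x).im = Real.sin x := by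
  rw [cis, mul_comm, Complex.exp_ofReal_mul_I_im]

theorem cis_int_mul_two_pi (m : ℤ) : cis (m * (2 * Real.pi)) = 1 := by
  rw [cis, Complex.exp_eq_one_iff]
  exact ⟨m, by push_cast; ring⟩

theorem norm_cis_sub_one (x : ℝ) : ‖cis x - 1‖ = 2 * |Real.sin (x / 2)| := by
  rw [cis, Complex.norm_exp_I_mul_ofReal_sub_one, norm_mul]
  simp

theorem norm_cis_sub_one_le (x : ℝ) : ‖cis x - 1‖ ≤ |x| :=
  Real.norm_exp_I_mul_ofReal_sub_one_le

theorem norm_cis_sub_cis_le (x y : ℝ) : ‖cis x - cis y‖ ≤ |x - y| := by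
  have : cis x - cis y = cis y * (cis (x - y) - 1) := by
    rw [mul_sub, ← cis_add]; simp
  rw [this, norm_mul, norm_cis, one_mul]
  exact norm_cis_sub_one_le _

/-! ### Real numbers with small sine -/

/-- Jordan's inequality `|sin u| ≥ (2/π) |u|` on `[-π/2, π/2]`, applied after subtracting the
nearest multiple of `π`. -/
theorem exists_int_abs_sub_mul_pi_le (x : ℝ) :
    ∃ b : ℤ, |x - b * Real.pi| ≤ Real.pi / 2 ∧
      |x - b * Real.pi| ≤ Real.pi / 2 * |Real.sin x| := by
  have hpi := Real.pi_pos
  refine ⟨round (x / Real.pi), ?_⟩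
  have h1 : |x - round (x / Real.pi) * Real.pi| ≤ Real.pi / 2 := by
    have h := abs_sub_round (x / Real.pi)
    have : x - round (x / Real.pi) * Real.pi
        = (x / Real.pi - round (x / Real.pi)) * Real.pi := by field_simp
    rw [this, abs_mul, abs_of_pos hpi]
    nlinarith
  refine ⟨h1, ?_⟩
  have h2 := Real.mul_abs_le_abs_sin h1
  rw [Real.sin_sub_int_mul_pi, abs_mul, abs_zpow, abs_neg, abs_one, one_zpow, one_mul] at h2
  calc |x - round (x / Real.pi) * Real.pi|
      = Real.pi / 2 * (2 / Real.pi * |x - round (x / Real.pi) * Real.pi|) := by field_simp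
    _ ≤ _ := by gcongr

theorem abs_le_of_abs_sin_le {x s : ℝ} (hx : |x| ≤ Real.pi / 2) (h : |Real.sin x| ≤ s) :
    |x| ≤ Real.pi / 2 * s := by
  have h2 := Real.mul_abs_le_abs_sin hx
  calc |x| = Real.pi / 2 * (2 / Real.pi * |x|) := by field_simp
    _ ≤ _ := by have := Real.pi_pos; gcongr; linarith

theorem abs_sin_add_int_mul_pi (x : ℝ) (b : ℤ) :
    |Real.sin (x + b * Real.pi)| = |Real.sin x| := by
  rw [Real.sin_add_int_mul_pi, abs_mul, abs_zpow, abs_neg, abs_one, one_zpow, one_mul]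

/-- If the first `H` multiples of `x` have small sine, then `x` is within `O(s / H)` of a multiple
of `π`. -/
theorem exists_int_mul_abs_sub_mul_pi_le {x s : ℝ} (hs : s ≤ 1 / 2) {H : ℕ} (hH : 1 ≤ H)
    (h : ∀ k : ℕ, 1 ≤ k → k ≤ H → |Real.sin (x * k)| ≤ s) :
    ∃ b : ℤ, H * |x - b * Real.pi| ≤ Real.pi / 2 * s := by
  have hpi := Real.pi_pos
  obtain ⟨b, hb1, hb2⟩ := exists_int_abs_sub_mul_pi_le x
  have h1 : |Real.sin x| ≤ s := by simpa using h 1 le_rfl hH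
  have hs0 : 0 ≤ s := (abs_nonneg _).trans h1
  have hbase : |x - b * Real.pi| ≤ Real.pi / 2 * s := hb2.trans (by gcongr)
  refine ⟨b, ?_⟩
  -- Induction on the multiple: the bound at `k`, with `s ≤ 1/2`, keeps the multiple `k + 1` of the
  -- remainder inside `[-π/2, π/2]`, where its small sine controls it. No wrap-around can occur.
  have key : ∀ k : ℕ, 1 ≤ k → k ≤ H → k * |x - b * Real.pi| ≤ Real.pi / 2 * s := by
    intro k hk
    induction k, hk using Nat.le_induction with
    | base => intro _; simpa using hbase
    | succ k hk ih =>
      intro hkH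
      have ih' := ih (by omega)
      have hle : |(x - b * Real.pi) * (k + 1 : ℕ)| ≤ Real.pi / 2 := by
        rw [abs_mul, Nat.abs_cast]
        push_cast
        nlinarith
      have hsin : |Real.sin ((x - b * Real.pi) * (k + 1 : ℕ))| ≤ s := by
        have := h (k + 1) (by omega) hkH
        have heq : (x - b * Real.pi) * (k + 1 : ℕ)
            = x * (k + 1 : ℕ) + ((-b * (k + 1 : ℕ) : ℤ) : ℝ) * Real.pi := by
          push_cast; ring
        rw [heq, abs_sin_add_int_mul_pi]
        exact this
      have := abs_le_of_abs_sin_le hle hsin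
      rwa [abs_mul, Nat.abs_cast, mul_comm] at this
  exact key H hH le_rfl

/-! ### Sums over a shifted range -/

theorem sum_Icc_telescope {E : Type*} [AddCommGroup E] (f : ℕ → E) (n : ℕ) :
    ∑ t ∈ Finset.Icc 1 n, (f (t + 1) - f t) = f (n + 1) - f 1 := by
  induction n with
  | zero => simp
  | succ n ih => rw [Finset.sum_Icc_succ_top (by omega), ih]; abel

theorem norm_sum_Icc_shift_sub_le {f : ℕ → ℂ} (hf : ∀ t, ‖f t‖ ≤ 1) (n h : ℕ) :
    ‖∑ t ∈ Finset.Icc 1 n, f (t + h) - ∑ t ∈ Finset.Icc 1 n, f t‖ ≤ 2 * h := by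
  induction h with
  | zero => simp
  | succ h ih =>
    have h1 : ∑ t ∈ Finset.Icc 1 n, f (t + (h + 1)) - ∑ t ∈ Finset.Icc 1 n, f t
        = (f (n + 1 + h) - f (1 + h))
          + (∑ t ∈ Finset.Icc 1 n, f (t + h) - ∑ t ∈ Finset.Icc 1 n, f t) := by
      rw [← sum_Icc_telescope (fun t => f (t + h)) n, Finset.sum_sub_distrib]
      have : ∀ t, f (t + (h + 1)) = f (t + 1 + h) := fun t => by congr 1; ring
      simp only [this]
      abel
    rw [h1]
    refine (norm_add_le _ _).trans ?_
    have := norm_sub_le (f (n + 1 + h)) (f (1 + h))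
    have h2 := hf (n + 1 + h)
    have h3 := hf (1 + h)
    push_cast
    linarith

/-- Geometric sum: multiplication by `cis (2 * x) - 1`, of modulus `2 |sin x|`, telescopes it to two
boundary terms. -/
theorem norm_sum_cis_mul_abs_sin_le (x : ℝ) (n : ℕ) :
    ‖∑ t ∈ Finset.Icc 1 n, cis (2 * x * t)‖ * |Real.sin x| ≤ 1 := by
  have h1 : (∑ t ∈ Finset.Icc 1 n, cis (2 * x * t)) * (cis (2 * x) - 1)
      = cis (2 * x * (n + 1 : ℕ)) - cis (2 * x * (1 : ℕ)) := by
    rw [← sum_Icc_telescope (fun t : ℕ => cis (2 * x * t)) n, Finset.sum_mul]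
    refine Finset.sum_congr rfl fun t _ => ?_
    rw [mul_sub, ← cis_add, mul_one]
    congr 2
    push_cast; ring
  have h2 := congrArg norm h1
  rw [norm_mul, norm_cis_sub_one, mul_div_cancel_left₀ x two_ne_zero] at h2
  have h3 := norm_sub_le (cis (2 * x * (n + 1 : ℕ))) (cis (2 * x * (1 : ℕ)))
  rw [norm_cis, norm_cis] at h3
  nlinarith

/-- Shifts of `f` that all correlate with the constant sequence cannot be almost orthogonal. -/
theorem norm_sum_sq_le_of_correlations {f : ℕ → ℂ} (hf : ∀ t, ‖f t‖ ≤ 1) {n K M : ℕ} {B : ℝ}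
    (hB0 : 0 ≤ B)
    (hB : ∀ i < K, ∀ j < K, i ≠ j →
      ‖∑ t ∈ Finset.Icc 1 n, f (t + i * M) * (starRingEnd ℂ) (f (t + j * M))‖ ≤ B) :
    ‖∑ t ∈ Finset.Icc 1 n, ∑ j ∈ Finset.range K, f (t + j * M)‖ ^ 2
      ≤ n * (K * n + K ^ 2 * B) := by
  have h1 : ‖∑ t ∈ Finset.Icc 1 n, ∑ j ∈ Finset.range K, f (t + j * M)‖ ^ 2
      ≤ n * ∑ t ∈ Finset.Icc 1 n, ‖∑ j ∈ Finset.range K, f (t + j * M)‖ ^ 2 := by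
    refine (pow_le_pow_left₀ (norm_nonneg _) (norm_sum_le _ _) 2).trans ?_
    simpa using sq_sum_le_card_mul_sum_sq (s := Finset.Icc 1 n)
      (f := fun t => ‖∑ j ∈ Finset.range K, f (t + j * M)‖)
  refine h1.trans ?_
  gcongr
  have h2 : ((∑ t ∈ Finset.Icc 1 n, ‖∑ j ∈ Finset.range K, f (t + j * M)‖ ^ 2 : ℝ) : ℂ)
      = ∑ i ∈ Finset.range K, ∑ j ∈ Finset.range K,
        ∑ t ∈ Finset.Icc 1 n, f (t + i * M) * (starRingEnd ℂ) (f (t + j * M)) := by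
    rw [Finset.sum_congr rfl fun i _ => Finset.sum_comm, Finset.sum_comm]
    push_cast
    refine Finset.sum_congr rfl fun t _ => ?_
    rw [← Complex.mul_conj', map_sum, Finset.sum_mul_sum]
  have h3 : ∑ t ∈ Finset.Icc 1 n, ‖∑ j ∈ Finset.range K, f (t + j * M)‖ ^ 2
      ≤ ∑ i ∈ Finset.range K, ∑ j ∈ Finset.range K,
        ‖∑ t ∈ Finset.Icc 1 n, f (t + i * M) * (starRingEnd ℂ) (f (t + j * M))‖ := by
    have h4 := congrArg norm h2
    rw [Complex.norm_real, Real.norm_of_nonneg (by positivity)] at h4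
    rw [h4]
    exact (norm_sum_le _ _).trans (Finset.sum_le_sum fun i _ => norm_sum_le _ _)
  refine h3.trans ?_
  -- In each row the diagonal term is at most `n` and every other term at most `B`.
  have h5 : ∀ i ∈ Finset.range K, ∑ j ∈ Finset.range K,
      ‖∑ t ∈ Finset.Icc 1 n, f (t + i * M) * (starRingEnd ℂ) (f (t + j * M))‖
      ≤ n + K * B := by
    intro i hi
    calc _ ≤ ∑ j ∈ Finset.range K, ((if j = i then (n : ℝ) else 0) + B) := by
          refine Finset.sum_le_sum fun j hj => ?_
          split_ifs with hij
          · subst hij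
            have : ‖∑ t ∈ Finset.Icc 1 n, f (t + j * M) * (starRingEnd ℂ) (f (t + j * M))‖
                ≤ ∑ t ∈ Finset.Icc 1 n, (1 : ℝ) := by
              refine norm_sum_le_of_le _ fun t _ => ?_
              rw [norm_mul, RCLike.norm_conj]
              have := hf (t + j * M)
              have h0 := norm_nonneg (f (t + j * M))
              nlinarith
            simp at this
            simpa using by linarith
          · rw [zero_add]
            exact hB i (Finset.mem_range.1 hi) j (Finset.mem_range.1 hj) (Ne.symm hij)
      _ = n + K * B := by
          rw [Finset.sum_add_distrib, Finset.sum_ite_eq' _ i, if_pos hi]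
          simp
  refine (Finset.sum_le_sum h5).trans (le_of_eq ?_)
  simp; ring

/-! ### Means of chirps -/

/-- The mean of `exp(i(γ₁ t + γ₂ t²))` over `t = 1, …, n`. -/
noncomputable def chirpMean (n : ℕ) (γ : ℝ × ℝ) : ℂ :=
  (∑ t ∈ Finset.Icc 1 n, cis (chirpPhase γ t)) / n

theorem norm_chirpMean_le_one (n : ℕ) (γ : ℝ × ℝ) : ‖chirpMean n γ‖ ≤ 1 := by
  rw [chirpMean, norm_div, Complex.norm_natCast]
  have : ‖∑ t ∈ Finset.Icc 1 n, cis (chirpPhase γ t)‖ ≤ ∑ t ∈ Finset.Icc 1 n, (1 : ℝ) :=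
    norm_sum_le_of_le _ fun t _ => (norm_cis _).le
  simp at this
  exact div_le_one_of_le₀ this (by positivity)

theorem chirpPhase_neg (γ : ℝ × ℝ) (t : ℕ) : chirpPhase (-γ) t = -chirpPhase γ t := by
  simp [chirpPhase]; ring

theorem chirpPhase_sub (γ γ' : ℝ × ℝ) (t : ℕ) :
    chirpPhase (γ - γ') t = chirpPhase γ t - chirpPhase γ' t := by
  simp [chirpPhase]; ring

theorem norm_chirpMean_neg (n : ℕ) (γ : ℝ × ℝ) : ‖chirpMean n (-γ)‖ = ‖chirpMean n γ‖ := by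
  have : chirpMean n (-γ) = (starRingEnd ℂ) (chirpMean n γ) := by
    simp [chirpMean, chirpPhase_neg, cis_neg]
  rw [this, RCLike.norm_conj]

/-- Van der Corput differencing. The correlation of two shifts of a quadratic phase is a geometric
sum, small unless the sine in question is small. If all were small, the `K` shifts would be almost
orthogonal, yet each keeps a sum of size at least `ε n / 2`. -/
theorem exists_abs_sin_mul_le {ε : ℝ} (hε : 0 < ε) {n K M : ℕ} {γ : ℝ × ℝ} (hn : 1 ≤ n)
    (hK : 8 < K * ε ^ 2) (hKM : (K * M : ℕ) ≤ ε * n / 4) (h : ε ≤ ‖chirpMean n γ‖) :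
    ∃ d : ℕ, 1 ≤ d ∧ d ≤ K ∧ |Real.sin (γ.2 * d * M)| ≤ 8 / (ε ^ 2 * n) := by
  by_contra! hcon
  have hn0 : (0 : ℝ) < n := by exact_mod_cast hn
  have hK0 : (0 : ℝ) < K := by
    rcases Nat.eq_zero_or_pos K with h0 | h0
    · subst h0; norm_num at hK
    · exact_mod_cast h0
  set f : ℕ → ℂ := fun t => cis (chirpPhase γ t) with hf
  have hf1 : ∀ t, ‖f t‖ ≤ 1 := fun t => (norm_cis _).le
  have hX : ε * n ≤ ‖∑ t ∈ Finset.Icc 1 n, f t‖ := by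
    rw [chirpMean, norm_div, Complex.norm_natCast, le_div_iff₀ hn0] at h
    exact h
  -- A shift by `j M ≤ K M` changes the sum by at most `2 K M ≤ ε n / 2`.
  have hlow : K * (ε * n / 2) ≤ ‖∑ t ∈ Finset.Icc 1 n, ∑ j ∈ Finset.range K, f (t + j * M)‖ := by
    rw [Finset.sum_comm]
    have h1 : ‖∑ j ∈ Finset.range K, (∑ t ∈ Finset.Icc 1 n, f (t + j * M)
        - ∑ t ∈ Finset.Icc 1 n, f t)‖ ≤ ∑ j ∈ Finset.range K, ε * n / 2 := by
      refine norm_sum_le_of_le _ fun j hj => (norm_sum_Icc_shift_sub_le hf1 n (j * M)).trans ?_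
      have : j * M ≤ K * M := Nat.mul_le_mul_right _ (Finset.mem_range.1 hj).le
      have : ((j * M : ℕ) : ℝ) ≤ (K * M : ℕ) := by exact_mod_cast this
      linarith
    rw [Finset.sum_sub_distrib] at h1
    simp only [Finset.sum_const, Finset.card_range, nsmul_eq_mul] at h1
    have h2 := norm_sub_norm_le (K * ∑ t ∈ Finset.Icc 1 n, f t)
      (∑ j ∈ Finset.range K, ∑ t ∈ Finset.Icc 1 n, f (t + j * M))
    rw [norm_sub_rev, norm_mul, Complex.norm_natCast] at h2
    nlinarith
  have hup := norm_sum_sq_le_of_correlations (f := f) hf1 (n := n) (K := K) (M := M)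
    (B := ε ^ 2 * n / 8) (by positivity) (by
      intro i hi j hj hij
      have hsin : 8 / (ε ^ 2 * n) ≤ |Real.sin (γ.2 * ((i : ℝ) - j) * M)| := by
        rcases lt_or_gt_of_ne hij with hlt | hlt
        · have := hcon (j - i) (by omega) (by omega)
          rw [Nat.cast_sub hlt.le] at this
          have heq : γ.2 * ((i : ℝ) - j) * M = -(γ.2 * ((j : ℝ) - i) * M) := by ring
          rw [heq, Real.sin_neg, abs_neg]
          exact this.le
        · have := hcon (i - j) (by omega) (by omega)
          rw [Nat.cast_sub hlt.le] at this
          exact this.le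
      have heq : ∑ t ∈ Finset.Icc 1 n, f (t + i * M) * (starRingEnd ℂ) (f (t + j * M))
          = cis (γ.1 * ((i : ℝ) - j) * M + γ.2 * ((i : ℝ) ^ 2 - j ^ 2) * M ^ 2) *
            ∑ t ∈ Finset.Icc 1 n, cis (2 * (γ.2 * ((i : ℝ) - j) * M) * t) := by
        rw [Finset.mul_sum]
        refine Finset.sum_congr rfl fun t _ => ?_
        rw [hf]
        simp only
        rw [← cis_neg, ← cis_add, ← cis_add]
        congr 1
        simp only [chirpPhase]
        push_cast
        ring
      rw [heq, norm_mul, norm_cis, one_mul]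
      have hg := norm_sum_cis_mul_abs_sin_le (γ.2 * ((i : ℝ) - j) * M) n
      have hg2 : ‖∑ t ∈ Finset.Icc 1 n, cis (2 * (γ.2 * ((i : ℝ) - j) * M) * t)‖
          * (8 / (ε ^ 2 * n)) ≤ 1 :=
        (mul_le_mul_of_nonneg_left hsin (norm_nonneg _)).trans hg
      rw [mul_div_assoc', div_le_one (by positivity)] at hg2
      linarith)
  -- Comparing `K² ε² n² / 4` with `K n² + K² ε² n² / 8` gives `K ε² ≤ 8`, against the choice of
  -- `K`.
  have h3 := (pow_le_pow_left₀ (by positivity) hlow 2).trans hup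
  have h4 : (K * n ^ 2 : ℝ) * (K * ε ^ 2) ≤ (K * n ^ 2) * 8 := by nlinarith
  have h5 := le_of_mul_le_mul_left h4 (by positivity)
  linarith

/-- A chirp whose mean is not small has its frequency rate close to a rational multiple of `π` of
bounded denominator. -/
theorem exists_rate_approx_of_le_norm_chirpMean {ε : ℝ} (hε : 0 < ε) :
    ∃ (Q : ℕ) (C : ℝ) (N : ℕ), 0 < C ∧ ∀ n ≥ N, ∀ γ : ℝ × ℝ, ε ≤ ‖chirpMean n γ‖ →
      ∃ q : ℕ, 1 ≤ q ∧ q ≤ Q ∧ ∃ b : ℤ, |γ.2 * q - b * Real.pi| * n ^ 2 ≤ C := by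
  have hpi := Real.pi_pos
  obtain ⟨K, hK⟩ := exists_nat_gt (8 / ε ^ 2)
  have hK' : 8 < K * ε ^ 2 := by rwa [div_lt_iff₀ (by positivity)] at hK
  have hK0 : (0 : ℝ) < K := lt_of_le_of_lt (by positivity) hK
  obtain ⟨C₁, hC₁⟩ : ∃ C₁ : ℝ, C₁ = Real.pi / 2 * (8 / ε ^ 2) := ⟨_, rfl⟩
  have hC₁0 : 0 < C₁ := by rw [hC₁]; positivity
  -- the proportion of the range used for long shifts
  obtain ⟨c, hc0, hcε, hcC⟩ : ∃ c : ℝ, 0 < c ∧ c ≤ ε / (4 * K ^ 2) ∧ c ≤ Real.pi / 2 / (K * C₁) :=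
    ⟨min (ε / (4 * K ^ 2)) (Real.pi / 2 / (K * C₁)), by positivity, min_le_left _ _,
      min_le_right _ _⟩
  obtain ⟨N, hN⟩ := exists_nat_gt (max (4 * K / ε) (2 / c))
  refine ⟨K, 2 * C₁ / c, max N 1, by positivity, fun n hn γ h => ?_⟩
  have hn1 : 1 ≤ n := le_of_max_le_right hn
  have hn0 : (0 : ℝ) < n := by exact_mod_cast hn1
  have hnN : (N : ℝ) ≤ n := by exact_mod_cast le_of_max_le_left hn
  have hnK : K ≤ ε * n / 4 := by
    have : 4 * K / ε < n := lt_of_lt_of_le ((le_max_left _ _).trans_lt hN) hnN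
    rw [div_lt_iff₀ hε] at this
    linarith
  have hnc : 2 ≤ c * n := by
    have : 2 / c < n := lt_of_lt_of_le ((le_max_right _ _).trans_lt hN) hnN
    rw [div_lt_iff₀ hc0] at this
    linarith
  obtain ⟨q, hq1, hqK, hq⟩ := exists_abs_sin_mul_le hε (M := 1) hn1 hK' (by simpa using hnK) h
  have hq0 : (0 : ℝ) < q := by exact_mod_cast hq1
  have hqK' : (q : ℝ) ≤ K := by exact_mod_cast hqK
  have hs : Real.pi / 2 * (8 / (ε ^ 2 * n)) = C₁ / n := by rw [hC₁]; field_simp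
  obtain ⟨b, -, hb⟩ := exists_int_abs_sub_mul_pi_le (γ.2 * q)
  refine ⟨q, hq1, hqK, b, ?_⟩
  have hρ1 : |γ.2 * q - b * Real.pi| ≤ C₁ / n := by
    rw [← hs]
    refine hb.trans ?_
    gcongr
    simpa using hq
  obtain ⟨ρ, hρ⟩ : ∃ ρ : ℝ, ρ = γ.2 * q - b * Real.pi := ⟨_, rfl⟩
  rw [← hρ] at hρ1 ⊢
  obtain ⟨m, hmle, hmge⟩ : ∃ m : ℕ, (m : ℝ) ≤ c * n ∧ c * n / 2 ≤ m :=
    ⟨⌊c * n⌋₊, Nat.floor_le (by positivity), by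
      have := Nat.lt_floor_add_one (c * n)
      linarith⟩
  have hKqm : ((K * (q * m) : ℕ) : ℝ) ≤ ε * n / 4 := by
    push_cast
    calc (K * (q * m) : ℝ) ≤ K * (K * (ε / (4 * K ^ 2) * n)) := by
          gcongr
          exact hmle.trans (by gcongr)
      _ = ε * n / 4 := by field_simp
  -- Shifts by `q m`, with `m` of order `n`, improve this to `O(1/n²)`: the multiple of `π` drops
  -- out of the sine, and the choice of `c` keeps `ρ d m` in `[-π/2, π/2]`, so a sine of order `1/n`
  -- bounds `|ρ| m`.
  obtain ⟨d, hd1, hdK, hd⟩ := exists_abs_sin_mul_le hε hn1 hK' hKqm h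
  have hd1' : (1 : ℝ) ≤ d := by exact_mod_cast hd1
  have hdK' : (d : ℝ) ≤ K := by exact_mod_cast hdK
  have hd' : |Real.sin (ρ * (d * m))| ≤ 8 / (ε ^ 2 * n) := by
    have : γ.2 * d * (q * m : ℕ) = ρ * (d * m) + ((b * d * m : ℤ) : ℝ) * Real.pi := by
      rw [hρ]; push_cast; ring
    rwa [this, abs_sin_add_int_mul_pi] at hd
  have hsmall : |ρ * (d * m)| ≤ Real.pi / 2 := by
    rw [abs_mul, abs_of_nonneg (by positivity : (0 : ℝ) ≤ d * m)]
    calc |ρ| * (d * m) ≤ C₁ / n * (K * (Real.pi / 2 / (K * C₁) * n)) := by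
          gcongr
          exact hmle.trans (by gcongr)
      _ = Real.pi / 2 := by field_simp
  have hρm : |ρ| * m ≤ C₁ / n := by
    have := abs_le_of_abs_sin_le hsmall hd'
    rw [hs, abs_mul, abs_of_nonneg (by positivity : (0 : ℝ) ≤ d * m)] at this
    refine le_trans ?_ this
    gcongr
    exact le_mul_of_one_le_left (Nat.cast_nonneg m) hd1'
  have h1 : |ρ| * (c * n / 2) ≤ C₁ / n := by
    refine le_trans ?_ hρm
    gcongr
  calc |ρ| * n ^ 2 = |ρ| * (c * n / 2) * (n * 2 / c) := by field_simp
    _ ≤ C₁ / n * (n * 2 / c) := by gcongr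
    _ = 2 * C₁ / c := by field_simp

/-- If the frequency rate is close to a multiple of `π / q`, a shift by `2 q` almost rotates the
chirp by a constant angle; so the frequency is close to a multiple of `π / q` unless the mean is
small. -/
theorem norm_chirpMean_mul_abs_sin_le {γ : ℝ × ℝ} {n q : ℕ} {b : ℤ} {C : ℝ}
    (h : |γ.2 * q - b * Real.pi| * n ^ 2 ≤ C) :
    ‖chirpMean n γ‖ * |Real.sin (γ.1 * q)| * n ≤ 2 * q + C * (2 + 2 * q) := by
  rcases Nat.eq_zero_or_pos n with rfl | hn1
  · have : 0 ≤ C := (by positivity : (0 : ℝ) ≤ _).trans h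
    simp; positivity
  have hn0 : (0 : ℝ) < n := by exact_mod_cast hn1
  have hn1' : (1 : ℝ) ≤ n := by exact_mod_cast hn1
  obtain ⟨ρ, hρ⟩ : ∃ ρ : ℝ, ρ = γ.2 * q - b * Real.pi := ⟨_, rfl⟩
  rw [← hρ] at h
  set f : ℕ → ℂ := fun t => cis (chirpPhase γ t) with hf
  have hf1 : ∀ t, ‖f t‖ ≤ 1 := fun t => (norm_cis _).le
  -- The shift is `2 q` rather than `q` so that the part `b π` of the rate contributes whole
  -- multiples of `2π` to the phase. What is left is a constant rotation and an error of order `|ρ|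
  -- n`.
  have hrot : ∀ t ∈ Finset.Icc 1 n, ‖f (t + 2 * q) - cis (2 * (γ.1 * q)) * f t‖
      ≤ C / n * (2 * (2 + 2 * q)) := by
    intro t ht
    have htn : (t : ℝ) ≤ n := by exact_mod_cast (Finset.mem_Icc.1 ht).2
    have h1 : f (t + 2 * q) - cis (2 * (γ.1 * q)) * f t
        = cis (2 * (γ.1 * q)) * f t * (cis (2 * ρ * (2 * t + 2 * q)) - 1) := by
      have h2 : chirpPhase γ (t + 2 * q) = 2 * (γ.1 * q) + chirpPhase γ t
          + 2 * ρ * (2 * t + 2 * q) + ((b * (2 * t + 2 * q) : ℤ) : ℝ) * (2 * Real.pi) := by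
        rw [hρ]; simp only [chirpPhase]; push_cast; ring
      rw [hf]
      simp only
      rw [h2, cis_add, cis_int_mul_two_pi, cis_add, cis_add]
      ring
    rw [h1, norm_mul, norm_mul, norm_cis, one_mul, norm_cis, one_mul]
    refine (norm_cis_sub_one_le _).trans ?_
    rw [abs_mul, abs_mul, abs_of_pos (two_pos : (0 : ℝ) < 2),
      abs_of_nonneg (by positivity : (0 : ℝ) ≤ 2 * t + 2 * q)]
    have h3 : (2 * t + 2 * q : ℝ) ≤ n * (2 + 2 * q) := by
      have : (q : ℝ) ≤ n * q := le_mul_of_one_le_left (Nat.cast_nonneg q) hn1'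
      linarith
    calc 2 * |ρ| * (2 * t + 2 * q) ≤ 2 * |ρ| * (n * (2 + 2 * q)) := by gcongr
      _ = |ρ| * n ^ 2 / n * (2 * (2 + 2 * q)) := by field_simp
      _ ≤ _ := by gcongr
  have hsum : ‖∑ t ∈ Finset.Icc 1 n, f (t + 2 * q)
      - cis (2 * (γ.1 * q)) * ∑ t ∈ Finset.Icc 1 n, f t‖ ≤ C * (2 * (2 + 2 * q)) := by
    rw [Finset.mul_sum, ← Finset.sum_sub_distrib]
    refine (norm_sum_le_of_le _ hrot).trans (le_of_eq ?_)
    rw [Finset.sum_const, Nat.card_Icc, nsmul_eq_mul, Nat.add_sub_cancel]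
    field_simp
  have hshift := norm_sum_Icc_shift_sub_le hf1 n (2 * q)
  have hmain : ‖cis (2 * (γ.1 * q)) - 1‖ * ‖∑ t ∈ Finset.Icc 1 n, f t‖
      ≤ 4 * q + C * (2 * (2 + 2 * q)) := by
    rw [← norm_mul]
    calc _ = ‖(∑ t ∈ Finset.Icc 1 n, f (t + 2 * q) - ∑ t ∈ Finset.Icc 1 n, f t)
          - (∑ t ∈ Finset.Icc 1 n, f (t + 2 * q)
            - cis (2 * (γ.1 * q)) * ∑ t ∈ Finset.Icc 1 n, f t)‖ := by congr 1; ring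
      _ ≤ _ := by
          refine (norm_sub_le _ _).trans ?_
          push_cast at hshift
          linarith
  rw [norm_cis_sub_one, mul_div_cancel_left₀ _ two_ne_zero] at hmain
  rw [chirpMean, norm_div, Complex.norm_natCast, mul_right_comm, div_mul_cancel₀ _ hn0.ne']
  linarith

/-- A chirp whose mean is not small has both frequencies close to rational multiples of `π` with a
bounded common denominator. -/
theorem exists_rational_approx_of_le_norm_chirpMean {ε : ℝ} (hε : 0 < ε) :
    ∃ (Q : ℕ) (C : ℝ) (N : ℕ), ∀ n ≥ N, ∀ γ : ℝ × ℝ, ε ≤ ‖chirpMean n γ‖ →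
      ∃ q : ℕ, 1 ≤ q ∧ q ≤ Q ∧ ∃ a b : ℤ,
        |q * γ.1 - a * Real.pi| ≤ C / n ∧ |q * γ.2 - b * Real.pi| ≤ C / n := by
  have hpi := Real.pi_pos
  obtain ⟨Q, C, N, hC, hQ⟩ := exists_rate_approx_of_le_norm_chirpMean hε
  refine ⟨Q, max C (Real.pi / 2 * ((2 * Q + C * (2 + 2 * Q)) / ε)), max N 1,
    fun n hn γ h => ?_⟩
  have hn1 : 1 ≤ n := le_of_max_le_right hn
  have hn0 : (0 : ℝ) < n := by exact_mod_cast hn1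
  have hn1' : (1 : ℝ) ≤ n := by exact_mod_cast hn1
  obtain ⟨q, hq1, hqQ, b, hb⟩ := hQ n (le_of_max_le_left hn) γ h
  have hqQ' : (q : ℝ) ≤ Q := by exact_mod_cast hqQ
  obtain ⟨a, -, ha⟩ := exists_int_abs_sub_mul_pi_le (γ.1 * q)
  refine ⟨q, hq1, hqQ, a, b, ?_, ?_⟩
  · rw [mul_comm (q : ℝ)]
    -- The mean is at least `ε`, so the bound on its product with the sine can be divided by `ε n`.
    have h1 : |Real.sin (γ.1 * q)| ≤ (2 * Q + C * (2 + 2 * Q)) / ε / n := by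
      rw [div_div, le_div_iff₀ (by positivity)]
      calc |Real.sin (γ.1 * q)| * (ε * n) ≤ |Real.sin (γ.1 * q)| * (‖chirpMean n γ‖ * n) := by
            gcongr
        _ = ‖chirpMean n γ‖ * |Real.sin (γ.1 * q)| * n := by ring
        _ ≤ 2 * q + C * (2 + 2 * q) := norm_chirpMean_mul_abs_sin_le hb
        _ ≤ _ := by gcongr
    refine ha.trans ?_
    calc _ ≤ Real.pi / 2 * ((2 * Q + C * (2 + 2 * Q)) / ε / n) := by gcongr
      _ = Real.pi / 2 * ((2 * Q + C * (2 + 2 * Q)) / ε) / n := by ring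
      _ ≤ _ := by gcongr; exact le_max_right _ _
  · rw [mul_comm (q : ℝ), le_div_iff₀ hn0]
    refine le_trans ?_ (hb.trans (le_max_left _ _))
    gcongr
    exact le_self_pow₀ hn1' two_ne_zero

/-! ### Chirps with a mean of modulus close to one -/

/-- The variance identity for unit vectors: modulus of the mean near one means that almost all
values are near the mean. -/
theorem sum_norm_sub_mean_sq {f : ℕ → ℂ} (hf : ∀ t, ‖f t‖ = 1) {n : ℕ} (hn : 1 ≤ n) {D : ℂ}
    (hD : D = (∑ t ∈ Finset.Icc 1 n, f t) / n) :
    ∑ t ∈ Finset.Icc 1 n, ‖f t - D‖ ^ 2 = n * (1 - ‖D‖ ^ 2) := by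
  have hn0 : (n : ℂ) ≠ 0 := by exact_mod_cast (by omega : n ≠ 0)
  have hS : ∑ t ∈ Finset.Icc 1 n, f t = n * D := by rw [hD]; field_simp
  have h1 : ((∑ t ∈ Finset.Icc 1 n, ‖f t - D‖ ^ 2 : ℝ) : ℂ) = ((n * (1 - ‖D‖ ^ 2) : ℝ) : ℂ) := by
    push_cast
    have h2 : ∀ t ∈ Finset.Icc 1 n, (‖f t - D‖ : ℂ) ^ 2
        = 1 - f t * (starRingEnd ℂ) D - (starRingEnd ℂ) (f t) * D + (‖D‖ : ℂ) ^ 2 := by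
      intro t _
      have h3 : f t * (starRingEnd ℂ) (f t) = 1 := by rw [Complex.mul_conj', hf]; simp
      rw [← Complex.mul_conj', ← Complex.mul_conj', map_sub]
      linear_combination h3
    rw [Finset.sum_congr rfl h2, Finset.sum_add_distrib, Finset.sum_sub_distrib,
      Finset.sum_sub_distrib, ← Finset.sum_mul, ← Finset.sum_mul, ← map_sum, hS, map_mul]
    simp only [Finset.sum_const, Nat.card_Icc, Nat.add_sub_cancel, nsmul_eq_mul, map_natCast]
    rw [← Complex.mul_conj']
    ring
  exact_mod_cast h1

/-- If the mean `D` of unit complex numbers has modulus close to one, any four shifts have a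
common time at which all values are close to `D`. -/
theorem exists_forall_norm_sub_mean_le {f : ℕ → ℂ} (hf : ∀ t, ‖f t‖ = 1) {n : ℕ} (hn : 4 ≤ n)
    {D : ℂ} (hD : D = (∑ t ∈ Finset.Icc 1 n, f t) / n) {σ : ℝ} (hσ : 0 ≤ σ)
    (h : 1 - σ ^ 2 / 24 ≤ ‖D‖) (s : Fin 4 → ℕ) (hs : ∀ i, s i + n / 2 ≤ n) :
    ∃ t, 1 ≤ t ∧ t ≤ n ∧ ∀ i, ‖f (t + s i) - D‖ ≤ σ := by
  by_contra! hcon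
  have hn0 : (0 : ℝ) < n := by exact_mod_cast (by omega : 0 < n)
  have hvar := sum_norm_sub_mean_sq hf (by omega) hD
  have hD1 : ‖D‖ ≤ 1 := by
    have h0 : 0 ≤ ∑ t ∈ Finset.Icc 1 n, ‖f t - D‖ ^ 2 := by positivity
    rw [hvar] at h0
    have := nonneg_of_mul_nonneg_right h0 hn0
    nlinarith [norm_nonneg D]
  -- The `24` is `2 · 4 · 3`: `1 - ‖D‖² ≤ 2 (1 - ‖D‖)`, four shifts are summed, and `n / 2`, rounded
  -- down, is at least `n / 3`.
  have hvar' : ∑ t ∈ Finset.Icc 1 n, ‖f t - D‖ ^ 2 ≤ n * (σ ^ 2 / 12) := by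
    rw [hvar]
    gcongr
    nlinarith [norm_nonneg D, sq_nonneg σ]
  have hup : ∑ t ∈ Finset.Icc 1 (n / 2), ∑ i, ‖f (t + s i) - D‖ ^ 2 ≤ 4 * (n * (σ ^ 2 / 12)) := by
    rw [Finset.sum_comm]
    have : ∀ i ∈ (Finset.univ : Finset (Fin 4)),
        ∑ t ∈ Finset.Icc 1 (n / 2), ‖f (t + s i) - D‖ ^ 2 ≤ n * (σ ^ 2 / 12) := by
      intro i _
      refine le_trans ?_ hvar'
      rw [← Finset.sum_image (s := Finset.Icc 1 (n / 2)) (g := fun t => t + s i)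
        (f := fun t => ‖f t - D‖ ^ 2) (fun a _ b _ hab => by simpa using hab)]
      refine Finset.sum_le_sum_of_subset_of_nonneg ?_ fun _ _ _ => by positivity
      intro t ht
      obtain ⟨u, hu, rfl⟩ := Finset.mem_image.1 ht
      have := hs i
      simp only [Finset.mem_Icc] at hu ⊢
      omega
    refine (Finset.sum_le_sum this).trans (le_of_eq ?_)
    simp
  have hlow : ((n / 2 : ℕ) : ℝ) * σ ^ 2
      < ∑ t ∈ Finset.Icc 1 (n / 2), ∑ i, ‖f (t + s i) - D‖ ^ 2 := by
    have h1 : ∑ t ∈ Finset.Icc 1 (n / 2), σ ^ 2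
        < ∑ t ∈ Finset.Icc 1 (n / 2), ∑ i, ‖f (t + s i) - D‖ ^ 2 := by
      refine Finset.sum_lt_sum_of_nonempty (Finset.nonempty_Icc.2 (by omega)) fun t ht => ?_
      rw [Finset.mem_Icc] at ht
      obtain ⟨i, hi⟩ := hcon t ht.1 (by omega)
      calc σ ^ 2 < ‖f (t + s i) - D‖ ^ 2 := by gcongr
        _ ≤ _ := Finset.single_le_sum (f := fun i => ‖f (t + s i) - D‖ ^ 2)
          (fun _ _ => by positivity) (Finset.mem_univ i)
    simpa using h1
  have h3 : (n : ℝ) ≤ 3 * (n / 2 : ℕ) := by exact_mod_cast (by omega : n ≤ 3 * (n / 2))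
  nlinarith [sq_nonneg σ]

/-- The values at `t`, `t + j`, `t + k`, `t + j + k` are all close to `D`, while the mixed second
difference of the phase is `2 γ.2 j k`, independent of `t` and of the frequency. -/
theorem abs_sin_rate_mul_le {n : ℕ} (hn : 4 ≤ n) {γ : ℝ × ℝ} {σ : ℝ} (hσ : 0 ≤ σ)
    (h : 1 - σ ^ 2 / 24 ≤ ‖chirpMean n γ‖) {j k : ℕ} (hj : j ≤ n / 4) (hk : k ≤ n / 4) :
    |Real.sin (γ.2 * j * k)| ≤ 2 * σ := by
  obtain ⟨t, -, -, ht⟩ := exists_forall_norm_sub_mean_le (f := fun t => cis (chirpPhase γ t))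
    (fun t => norm_cis _) hn rfl hσ h ![0, j, k, j + k] (by
      intro i
      fin_cases i <;> simp <;> omega)
  set D := (∑ t ∈ Finset.Icc 1 n, cis (chirpPhase γ t)) / n
  have h0 := ht 0
  have h1 := ht 1
  have h2 := ht 2
  have h3 := ht 3
  simp only [Matrix.cons_val] at h0 h1 h2 h3
  have hprod : ∀ x y : ℝ, ‖cis x - D‖ ≤ σ → ‖cis y - D‖ ≤ σ →
      ‖cis x * cis y - D * D‖ ≤ 2 * σ := by
    intro x y hx hy
    have hD : ‖D‖ ≤ 1 := norm_chirpMean_le_one n γ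
    have : cis x * cis y - D * D = cis x * (cis y - D) + D * (cis x - D) := by ring
    rw [this]
    refine (norm_add_le _ _).trans ?_
    rw [norm_mul, norm_mul, norm_cis]
    nlinarith [norm_nonneg (cis x - D)]
  have hdiff := norm_sub_le_norm_sub_add_norm_sub
    (cis (chirpPhase γ (t + (j + k))) * cis (chirpPhase γ (t + 0))) (D * D)
    (cis (chirpPhase γ (t + j)) * cis (chirpPhase γ (t + k)))
  rw [norm_sub_rev (D * D)] at hdiff
  have heq : cis (chirpPhase γ (t + (j + k))) * cis (chirpPhase γ (t + 0))
      - cis (chirpPhase γ (t + j)) * cis (chirpPhase γ (t + k))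
      = cis (chirpPhase γ (t + j)) * cis (chirpPhase γ (t + k))
        * (cis (2 * (γ.2 * j * k)) - 1) := by
    rw [mul_sub, ← cis_add, ← cis_add, ← cis_add, mul_one]
    congr 2
    simp only [chirpPhase]
    push_cast
    ring
  rw [heq, norm_mul, norm_mul, norm_cis, norm_cis, norm_cis_sub_one,
    mul_div_cancel_left₀ _ two_ne_zero] at hdiff
  have := hprod _ _ h3 h0
  have := hprod _ _ h1 h2
  linarith

/-- Compares the values at `t` and `t + j`. As `j² - j` is even, `b π j²` equals `b π j` modulo
`2π`, so a rate near `b π` acts like an additional frequency `b π`; this produces the parity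
condition on `a + b` later. -/
theorem abs_sin_frequency_mul_le {n : ℕ} (hn : 4 ≤ n) {γ : ℝ × ℝ} {σ : ℝ} (hσ : 0 ≤ σ)
    (h : 1 - σ ^ 2 / 24 ≤ ‖chirpMean n γ‖) (b : ℤ) {j : ℕ} (hj : j ≤ n / 4) :
    |Real.sin ((γ.1 + b * Real.pi) / 2 * j)| ≤ σ + 3 / 2 * (|γ.2 - b * Real.pi| * n ^ 2) := by
  obtain ⟨t, -, htn, ht⟩ := exists_forall_norm_sub_mean_le (f := fun t => cis (chirpPhase γ t))
    (fun t => norm_cis _) hn rfl hσ h ![0, j, 0, 0] (by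
      intro i
      fin_cases i <;> simp <;> omega)
  set D := (∑ t ∈ Finset.Icc 1 n, cis (chirpPhase γ t)) / n
  have h0 := ht 0
  have h1 := ht 1
  simp only [Matrix.cons_val, add_zero] at h0 h1
  have hdiff := norm_sub_le_norm_sub_add_norm_sub (cis (chirpPhase γ (t + j))) D
    (cis (chirpPhase γ t))
  rw [norm_sub_rev D] at hdiff
  obtain ⟨m, hm⟩ : ∃ m : ℕ, j * j = j + 2 * m := by
    obtain ⟨r, hr⟩ := Nat.even_mul_pred_self j
    refine ⟨r, ?_⟩
    cases j with
    | zero => simp at hr ⊢; omega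
    | succ j => simp at hr; nlinarith
  have hm' : (j : ℝ) ^ 2 = j + 2 * m := by rw [sq]; exact_mod_cast hm
  set x : ℝ := (γ.1 + b * Real.pi) * j with hx
  set z : ℝ := (γ.2 - b * Real.pi) * (2 * t * j + j ^ 2) with hz
  have heq : cis (chirpPhase γ (t + j)) - cis (chirpPhase γ t)
      = cis (chirpPhase γ t) * (cis (x + z) - 1) := by
    have : chirpPhase γ (t + j) = chirpPhase γ t + (x + z)
        + ((b * (t * j + m) : ℤ) : ℝ) * (2 * Real.pi) := by
      rw [hx, hz]
      simp only [chirpPhase]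
      push_cast
      linear_combination (b * Real.pi) * hm'
    rw [this, cis_add, cis_int_mul_two_pi, cis_add]
    ring
  rw [heq, norm_mul, norm_cis, one_mul] at hdiff
  have hxz : ‖cis x - 1‖ ≤ 2 * σ + |z| := by
    have h2 := norm_sub_le_norm_sub_add_norm_sub (cis x) (cis (x + z)) 1
    have h3 := norm_cis_sub_cis_le x (x + z)
    rw [sub_add_cancel_left, abs_neg] at h3
    linarith
  have hzle : |z| ≤ 3 * (|γ.2 - b * Real.pi| * n ^ 2) := by
    rw [hz, abs_mul, abs_of_nonneg (by positivity : (0 : ℝ) ≤ 2 * t * j + j ^ 2)]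
    have htn' : (t : ℝ) ≤ n := by exact_mod_cast htn
    have hjn : (j : ℝ) ≤ n := by exact_mod_cast (by omega : j ≤ n)
    calc _ ≤ |γ.2 - b * Real.pi| * (2 * n * n + n ^ 2) := by gcongr
      _ = _ := by ring
  rw [norm_cis_sub_one] at hxz
  have : (γ.1 + b * Real.pi) / 2 * j = x / 2 := by rw [hx]; ring
  rw [this]
  linarith

/-- A chirp whose mean has modulus close to one is almost constant up to resonance: the frequencies
are within `o(1 / n)` and `o(1 / n²)` of multiples `a π`, `b π` with `a + b` even. -/
theorem exists_abs_sub_mul_pi_le_of_norm_chirpMean {η : ℝ} (hη : 0 < η) :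
    ∃ κ > 0, ∀ n ≥ 4, ∀ γ : ℝ × ℝ, 1 - κ ≤ ‖chirpMean n γ‖ →
      ∃ a b : ℤ, Even (a + b) ∧ |γ.1 - a * Real.pi| * n ≤ η ∧ |γ.2 - b * Real.pi| * n ^ 2 ≤ η := by
  have hpi := Real.pi_pos
  have hpi4 := Real.pi_le_four
  obtain ⟨σ, hσ, hσ1, hση⟩ : ∃ σ : ℝ, 0 < σ ∧ σ ≤ 1 / 1000 ∧ σ ≤ η / 20000 :=
    ⟨min (1 / 1000) (η / 20000), by positivity, min_le_left _ _, min_le_right _ _⟩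
  refine ⟨σ ^ 2 / 24, by positivity, fun n hn γ h => ?_⟩
  obtain ⟨K, hK⟩ : ∃ K, K = n / 4 := ⟨_, rfl⟩
  have hK1 : 1 ≤ K := by omega
  have hK1' : (1 : ℝ) ≤ K := by exact_mod_cast hK1
  have hnK : (n : ℝ) ≤ 8 * K := by exact_mod_cast (by omega : n ≤ 8 * K)
  have hrate : ∀ j k : ℕ, j ≤ K → k ≤ K → |Real.sin (γ.2 * j * k)| ≤ 2 * σ := fun j k hj hk =>
    abs_sin_rate_mul_le hn hσ.le h (hK ▸ hj) (hK ▸ hk)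
  obtain ⟨b, hb⟩ := exists_int_mul_abs_sub_mul_pi_le (x := γ.2) (s := 2 * σ) (by linarith) hK1
    fun k hk hkK => by simpa using hrate 1 k hK1 hkK
  obtain ⟨ρ, hρ⟩ : ∃ ρ : ℝ, ρ = γ.2 - b * Real.pi := ⟨_, rfl⟩
  rw [← hρ] at hb
  -- The same argument for `ρ K` in place of `γ.2` gains a second factor `K`. The first bound makes
  -- `ρ K` small, which rules out a nonzero `b'`.
  obtain ⟨b', hb'⟩ := exists_int_mul_abs_sub_mul_pi_le (x := ρ * K) (s := 2 * σ) (by linarith) hK1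
    fun k hk hkK => by
      have h1 := hrate K k le_rfl hkK
      have h2 : γ.2 * K * k = ρ * K * k + ((b * K * k : ℤ) : ℝ) * Real.pi := by
        rw [hρ]; push_cast; ring
      rwa [h2, abs_sin_add_int_mul_pi] at h1
  have hb'0 : b' = 0 := by
    by_contra hne
    have h1 : (1 : ℝ) ≤ |(b' : ℝ)| := by exact_mod_cast Int.one_le_abs hne
    have h2 : |ρ * K - b' * Real.pi| ≤ Real.pi / 2 * (2 * σ) :=
      (le_mul_of_one_le_left (abs_nonneg _) hK1').trans hb'
    have h3 : |b' * Real.pi| ≤ |ρ * K| + |ρ * K - b' * Real.pi| := by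
      have := abs_sub (ρ * K) (ρ * K - b' * Real.pi)
      rwa [sub_sub_cancel] at this
    rw [abs_mul, abs_mul, abs_of_pos hpi, Nat.abs_cast, mul_comm |ρ|] at h3
    nlinarith
  subst hb'0
  rw [Int.cast_zero, zero_mul, sub_zero, abs_mul, Nat.abs_cast] at hb'
  have hρn : |ρ| * n ^ 2 ≤ 256 * σ := by
    calc |ρ| * n ^ 2 ≤ |ρ| * (8 * K) ^ 2 := by gcongr
      _ = 64 * (K * (|ρ| * K)) := by ring
      _ ≤ 64 * (Real.pi / 2 * (2 * σ)) := by gcongr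
      _ ≤ _ := by nlinarith
  -- Here `385 = 1 + (3/2) · 256`, from the bound `256 σ` on `|ρ| n²`; `σ ≤ 1/1000` keeps this below
  -- `1/2`.
  obtain ⟨m, hm⟩ := exists_int_mul_abs_sub_mul_pi_le (x := (γ.1 + b * Real.pi) / 2)
    (s := 385 * σ) (by linarith) hK1 fun k hk hkK => by
      have := abs_sin_frequency_mul_le hn hσ.le h b (hK ▸ hkK)
      rw [← hρ] at this
      linarith
  refine ⟨2 * m - b, b, ⟨m, by ring⟩, ?_, ?_⟩
  · have h1 : γ.1 - ((2 * m - b : ℤ) : ℝ) * Real.pi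
        = 2 * ((γ.1 + b * Real.pi) / 2 - m * Real.pi) := by push_cast; ring
    rw [h1, abs_mul, abs_of_pos two_pos]
    calc 2 * |(γ.1 + b * Real.pi) / 2 - m * Real.pi| * n
        ≤ 2 * |(γ.1 + b * Real.pi) / 2 - m * Real.pi| * (8 * K) := by gcongr
      _ = 16 * (K * |(γ.1 + b * Real.pi) / 2 - m * Real.pi|) := by ring
      _ ≤ 16 * (Real.pi / 2 * (385 * σ)) := by gcongr
      _ ≤ η := by nlinarith
  · rw [← hρ]
    linarith

/-! ### Nonexceptional frequencies -/

theorem IsExceptional.neg {α : ℝ × ℝ} (h : IsExceptional α) : IsExceptional (-α) := by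
  obtain ⟨a, b, rfl⟩ := h
  exact ⟨-a, -b, by simp⟩

/-- Multiples of a nonexceptional pair with bounded factors stay away from the lattice `(π ℤ)²`. -/
theorem exists_forall_not_close_of_not_isExceptional {α : ℝ × ℝ} (hα : ¬ IsExceptional α) (Q : ℕ) :
    ∃ r > 0, ∀ q : ℕ, 1 ≤ q → q ≤ Q → ∀ a b : ℤ,
      ¬ (|q * α.1 - a * Real.pi| ≤ r ∧ |q * α.2 - b * Real.pi| ≤ r) := by
  have hpi := Real.pi_pos
  -- The nearest multiple of `π` beats every other one, so integers depending on the tolerance can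
  -- be replaced by fixed ones and the tolerance sent to zero.
  have hround : ∀ (x : ℝ) (a : ℤ),
      |x - round (x / Real.pi) * Real.pi| ≤ |x - a * Real.pi| := by
    intro x a
    have h := round_le (x / Real.pi) a
    have h2 : ∀ c : ℤ, |x - c * Real.pi| = |x / Real.pi - c| * Real.pi := fun c => by
      rw [← abs_of_pos hpi, ← abs_mul, abs_of_pos hpi]
      congr 1
      field_simp
    rw [h2, h2]
    gcongr
  have hone : ∀ q : ℕ, 1 ≤ q → ∃ r > 0, ∀ a b : ℤ,
      r < |q * α.1 - a * Real.pi| ∨ r < |q * α.2 - b * Real.pi| := by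
    intro q hq
    have hq0 : (q : ℝ) ≠ 0 := by exact_mod_cast (by omega : q ≠ 0)
    by_contra! hcon
    refine hα ⟨round (q * α.1 / Real.pi) / q, round (q * α.2 / Real.pi) / q, ?_⟩
    have h0 : ∀ i : ℝ, (∀ r > 0, |q * i - round (q * i / Real.pi) * Real.pi| ≤ r) →
        i = (((round (q * i / Real.pi) : ℚ) / q : ℚ) : ℝ) * Real.pi := by
      intro i hi
      have : q * i - round (q * i / Real.pi) * Real.pi = 0 := by
        rw [← abs_nonpos_iff]
        exact le_of_forall_pos_le_add fun r hr => by simpa using hi r hr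
      rw [Rat.cast_div, Rat.cast_intCast, Rat.cast_natCast, div_mul_eq_mul_div, eq_div_iff hq0]
      linarith
    refine Prod.ext (h0 _ fun r hr => ?_) (h0 _ fun r hr => ?_)
    · obtain ⟨a, b, h1, -⟩ := hcon r hr
      exact (hround _ a).trans h1
    · obtain ⟨a, b, -, h1⟩ := hcon r hr
      exact (hround _ b).trans h1
  induction Q with
  | zero => exact ⟨1, one_pos, fun q h1 h2 => by omega⟩
  | succ Q ih =>
    obtain ⟨r, hr, h⟩ := ih
    obtain ⟨r', hr', h'⟩ := hone (Q + 1) (by omega)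
    refine ⟨min r r', by positivity, fun q h1 h2 a b ⟨ha, hb⟩ => ?_⟩
    rcases Nat.lt_or_ge Q q with hlt | hle
    · obtain rfl : q = Q + 1 := by omega
      rcases h' a b with h3 | h3
      · exact absurd (ha.trans (min_le_right _ _)) (not_le.2 h3)
      · exact absurd (hb.trans (min_le_right _ _)) (not_le.2 h3)
    · exact h q h1 hle a b ⟨ha.trans (min_le_left _ _), hb.trans (min_le_left _ _)⟩

/-- The means of chirps tend to zero locally uniformly off the exceptional set. -/
theorem exists_forall_dist_lt_norm_chirpMean_le {α : ℝ × ℝ} (hα : ¬ IsExceptional α) {ε : ℝ}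
    (hε : 0 < ε) :
    ∃ r > 0, ∃ N : ℕ, ∀ n ≥ N, ∀ β, dist β α < r → ‖chirpMean n β‖ ≤ ε := by
  obtain ⟨Q, C, N, h⟩ := exists_rational_approx_of_le_norm_chirpMean hε
  obtain ⟨r, hr, hα⟩ := exists_forall_not_close_of_not_isExceptional hα Q
  obtain ⟨N', hN'⟩ := exists_nat_gt (2 * C / r)
  refine ⟨r / (2 * (Q + 1)), by positivity, max N (max N' 1), fun n hn β hβ => ?_⟩
  simp only [ge_iff_le, max_le_iff] at hn
  have hn0 : (0 : ℝ) < n := by exact_mod_cast hn.2.2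
  have hCn : C / n ≤ r / 2 := by
    have : (N' : ℝ) ≤ n := by exact_mod_cast hn.2.1
    rw [div_lt_iff₀ hr] at hN'
    rw [div_le_div_iff₀ hn0 two_pos]
    nlinarith
  by_contra! hcon
  obtain ⟨q, hq1, hqQ, a, b, ha, hb⟩ := h n hn.1 β hcon.le
  have hqQ' : (q : ℝ) ≤ Q := by exact_mod_cast hqQ
  have hmul : ∀ x y c : ℝ, |x - y| < r / (2 * (Q + 1)) → |q * x - c| ≤ C / n → |q * y - c| ≤ r := by
    intro x y c hxy hx
    have h1 : |q * (x - y)| ≤ r / 2 := by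
      rw [abs_mul, Nat.abs_cast]
      calc q * |x - y| ≤ (Q + 1) * (r / (2 * (Q + 1))) := by gcongr; linarith
        _ = r / 2 := by field_simp
    have h2 := abs_sub (q * x - c) (q * (x - y))
    rw [show q * x - c - q * (x - y) = q * y - c by ring] at h2
    linarith
  rw [Prod.dist_eq, max_lt_iff, Real.dist_eq, Real.dist_eq] at hβ
  exact hα q hq1 hqQ a b ⟨hmul _ _ _ hβ.1 ha, hmul _ _ _ hβ.2 hb⟩

/-- Two chirps with a nonexceptional difference do not have large means simultaneously, uniformly
in the chirps. -/
theorem eventually_norm_chirpMean_le_or {α : ℝ × ℝ} (hα : ¬ IsExceptional α) {ε : ℝ}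
    (hε : 0 < ε) :
    ∀ᶠ n in atTop, ∀ γ, ‖chirpMean n γ‖ ≤ ε ∨ ‖chirpMean n (γ + α)‖ ≤ ε := by
  obtain ⟨Q, C, N, h⟩ := exists_rational_approx_of_le_norm_chirpMean hε
  obtain ⟨r, hr, hα⟩ := exists_forall_not_close_of_not_isExceptional hα (Q * Q)
  obtain ⟨N', hN'⟩ := exists_nat_gt (2 * Q * C / r)
  filter_upwards [eventually_ge_atTop N, eventually_ge_atTop N', eventually_ge_atTop 1]
    with n hn1 hn2 hn3 γ
  have hn0 : (0 : ℝ) < n := by exact_mod_cast hn3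
  have hCn : 2 * Q * C / n ≤ r := by
    have : (N' : ℝ) ≤ n := by exact_mod_cast hn2
    rw [div_lt_iff₀ hr] at hN'
    rw [div_le_iff₀ hn0]
    nlinarith
  by_contra! hcon
  obtain ⟨q, hq1, hqQ, a, b, ha, hb⟩ := h n hn1 _ hcon.1.le
  obtain ⟨q', hq1', hqQ', a', b', ha', hb'⟩ := h n hn1 _ hcon.2.le
  have hqR : (q : ℝ) ≤ Q := by exact_mod_cast hqQ
  have hqR' : (q' : ℝ) ≤ Q := by exact_mod_cast hqQ'
  -- Cross-multiplication by `q` and `q'` eliminates the common frequency and leaves the multiple `q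
  -- q'` of `α`, hence the bound `Q * Q` on the factors.
  have hcomb : ∀ (x y : ℝ) (c c' : ℤ), |q * x - c * Real.pi| ≤ C / n →
      |q' * (x + y) - c' * Real.pi| ≤ C / n →
      |(q * q' : ℕ) * y - (q * c' - q' * c : ℤ) * Real.pi| ≤ r := by
    intro x y c c' h1 h2
    have h3 : ((q * q' : ℕ) : ℝ) * y - (q * c' - q' * c : ℤ) * Real.pi
        = q * (q' * (x + y) - c' * Real.pi) - q' * (q * x - c * Real.pi) := by
      push_cast; ring
    rw [h3]
    refine (abs_sub _ _).trans ?_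
    rw [abs_mul, abs_mul, Nat.abs_cast, Nat.abs_cast]
    have hC0 : 0 ≤ C / n := (abs_nonneg _).trans h1
    calc _ ≤ Q * (C / n) + Q * (C / n) := by gcongr
      _ = 2 * Q * C / n := by ring
      _ ≤ r := hCn
  exact hα (q * q') (Nat.mul_pos hq1 hq1') (Nat.mul_le_mul hqQ hqQ') _ _
    ⟨hcomb _ _ _ _ ha ha', hcomb _ _ _ _ hb hb'⟩

/-! ### Demodulation of sums of complex chirps -/

/-- The mean of `z(t) exp(-i(θ₁ t + θ₂ t²))` over `t = 1, …, n`. -/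
noncomputable def demod (n : ℕ) (z : ℕ → ℂ) (θ : ℝ × ℝ) : ℂ :=
  (∑ t ∈ Finset.Icc 1 n, z t * cis (-chirpPhase θ t)) / n

/-- The sum of complex chirps with coefficients `C` and frequency pairs `F`. -/
noncomputable def chirpSum {ι : Type*} [Fintype ι] (C : ι → ℂ) (F : ι → ℝ × ℝ) (t : ℕ) : ℂ :=
  ∑ a, C a * cis (chirpPhase (F a) t)

/-- Sequences `w n` whose demodulations tend to zero uniformly on `U`. -/
def IsNegligibleOn (U : Set (ℝ × ℝ)) (w : ℕ → ℕ → ℂ) : Prop :=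
  ∀ ε > 0, ∀ᶠ n in atTop, ∀ θ ∈ U, ‖demod n (w n) θ‖ ≤ ε

/-- The distance of chirps of length `n` in terms of their frequency pairs. -/
def chirpDist (n : ℕ) (θ θ' : ℝ × ℝ) : ℝ := |θ.1 - θ'.1| * n + |θ.2 - θ'.2| * n ^ 2

theorem demod_add (n : ℕ) (z w : ℕ → ℂ) (θ : ℝ × ℝ) :
    demod n (fun t => z t + w t) θ = demod n z θ + demod n w θ := by
  simp [demod, add_mul, Finset.sum_add_distrib, add_div]

theorem norm_demod_le_of_forall_le {n : ℕ} {z : ℕ → ℂ} {B : ℝ} (hB : 0 ≤ B)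
    (h : ∀ t ≤ n, ‖z t‖ ≤ B) (θ : ℝ × ℝ) : ‖demod n z θ‖ ≤ B := by
  rw [demod, norm_div, Complex.norm_natCast]
  refine div_le_of_le_mul₀ (by positivity) hB ?_
  have : ‖∑ t ∈ Finset.Icc 1 n, z t * cis (-chirpPhase θ t)‖ ≤ ∑ t ∈ Finset.Icc 1 n, B := by
    refine norm_sum_le_of_le _ fun t ht => ?_
    rw [norm_mul, norm_cis, mul_one]
    exact h t (Finset.mem_Icc.1 ht).2
  refine this.trans (le_of_eq ?_)
  simp [mul_comm]

theorem demod_chirpSum {ι : Type*} [Fintype ι] (C : ι → ℂ) (F : ι → ℝ × ℝ) (n : ℕ) (θ : ℝ × ℝ) :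
    demod n (chirpSum C F) θ = ∑ a, C a * chirpMean n (F a - θ) := by
  simp only [demod, chirpSum, chirpMean, Finset.sum_mul, mul_div_assoc', Finset.mul_sum]
  rw [Finset.sum_comm, Finset.sum_div]
  refine Finset.sum_congr rfl fun a _ => ?_
  congr 1
  refine Finset.sum_congr rfl fun t _ => ?_
  rw [chirpPhase_sub, sub_eq_add_neg, cis_add, mul_assoc]

theorem abs_chirpPhase_sub_le {n t : ℕ} (ht : t ≤ n) (θ θ' : ℝ × ℝ) :
    |chirpPhase θ t - chirpPhase θ' t| ≤ chirpDist n θ θ' := by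
  have ht' : (t : ℝ) ≤ n := by exact_mod_cast ht
  have : chirpPhase θ t - chirpPhase θ' t = (θ.1 - θ'.1) * t + (θ.2 - θ'.2) * t ^ 2 := by
    simp only [chirpPhase]; ring
  rw [this]
  refine (abs_add_le _ _).trans ?_
  rw [abs_mul, abs_mul, Nat.abs_cast, abs_pow, Nat.abs_cast, chirpDist]
  gcongr

theorem norm_chirpMean_sub_one_le {n : ℕ} (hn : 1 ≤ n) (θ θ' : ℝ × ℝ) :
    ‖chirpMean n (θ - θ') - 1‖ ≤ chirpDist n θ θ' := by
  have hd : 0 ≤ chirpDist n θ θ' := by unfold chirpDist; positivity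
  have h : chirpMean n (θ - θ') - 1
      = demod n (fun t => cis (chirpPhase (θ - θ') t) - 1) 0 := by
    have h0 : ∀ t, cis (-chirpPhase 0 t) = 1 := fun t => by simp [chirpPhase, cis_zero]
    have hn0 : (n : ℂ) ≠ 0 := by exact_mod_cast (by omega : n ≠ 0)
    simp [demod, h0, chirpMean, sub_div, hn0]
  rw [h]
  refine norm_demod_le_of_forall_le hd (fun t ht => ?_) 0
  refine (norm_cis_sub_one_le _).trans ?_
  rw [chirpPhase_sub]
  exact abs_chirpPhase_sub_le ht θ θ'

theorem norm_sum_mul_le_of_forall_ne {ι : Type*} [Fintype ι] (C D : ι → ℂ) {b : ι}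
    {ε : ℝ} (hε : 0 ≤ ε) (h : ∀ a, a ≠ b → ‖D a‖ ≤ ε) :
    ‖∑ a, C a * D a - C b * D b‖ ≤ (∑ a, ‖C a‖) * ε := by
  classical
  rw [← Finset.add_sum_erase _ _ (Finset.mem_univ b), add_sub_cancel_left, Finset.sum_mul]
  refine (norm_sum_le_of_le _ (f := fun a => C a * D a) (n := fun a => ‖C a‖ * ε)
    fun a ha => ?_).trans ?_
  · rw [norm_mul]
    gcongr
    exact h a (Finset.ne_of_mem_erase ha)
  · exact Finset.sum_le_sum_of_subset_of_nonneg (Finset.erase_subset _ _)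
      fun _ _ _ => by positivity

/-- From some `n` on, which does not depend on `θ`, at most one component is visible at each `θ`. -/
theorem eventually_all_ne_norm_chirpMean_le_or {ι : Type*} [Fintype ι] {F : ι → ℝ × ℝ}
    (hF : ∀ a b, a ≠ b → ¬ IsExceptional (F a - F b)) {ε : ℝ} (hε : 0 < ε) :
    ∀ᶠ n in atTop, ∀ θ, ∀ a b, a ≠ b →
      ‖chirpMean n (F a - θ)‖ ≤ ε ∨ ‖chirpMean n (F b - θ)‖ ≤ ε := by
  have : ∀ᶠ n in atTop, ∀ a b, a ≠ b →
      ∀ γ, ‖chirpMean n γ‖ ≤ ε ∨ ‖chirpMean n (γ + (F a - F b))‖ ≤ ε := by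
    simp only [eventually_all]
    exact fun a b hab => eventually_norm_chirpMean_le_or (hF a b hab) hε
  filter_upwards [this] with n hn θ a b hab
  have := hn a b hab (F b - θ)
  rw [show F b - θ + (F a - F b) = F a - θ by abel] at this
  exact this.symm

section Peak

variable {ι : Type*} [Fintype ι] {F : ι → ℝ × ℝ} {C : ι → ℂ} {a₀ : ι}
  {U : Set (ℝ × ℝ)} {w : ℕ → ℕ → ℂ} {θ : ℕ → ℝ × ℝ}

theorem eventually_forall_ne_norm_chirpMean_le
    (hF : ∀ a b, a ≠ b → ¬ IsExceptional (F a - F b)) {ε : ℝ} (hε : 0 < ε)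
    (h : ∀ᶠ n in atTop, ε < ‖chirpMean n (F a₀ - θ n)‖) :
    ∀ᶠ n in atTop, ∀ a, a ≠ a₀ → ‖chirpMean n (F a - θ n)‖ ≤ ε := by
  filter_upwards [h, eventually_all_ne_norm_chirpMean_le_or hF hε] with n h1 h2 a ha
  exact (h2 (θ n) a a₀ ha).resolve_right (not_le.2 h1)

/-- The demodulation at frequency pairs that are close to those of a component tends to the
coefficient of that component. -/
theorem tendsto_demod_of_tendsto_chirpDist
    (hF : ∀ a b, a ≠ b → ¬ IsExceptional (F a - F b)) (hw : IsNegligibleOn U w)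
    (hθU : ∀ᶠ n in atTop, θ n ∈ U)
    (hθ : Tendsto (fun n => chirpDist n (F a₀) (θ n)) atTop (𝓝 0)) :
    Tendsto (fun n => demod n (fun t => chirpSum C F t + w n t) (θ n)) atTop (𝓝 (C a₀)) := by
  have hone : Tendsto (fun n => chirpMean n (F a₀ - θ n)) atTop (𝓝 1) := by
    rw [tendsto_iff_norm_sub_tendsto_zero]
    refine squeeze_zero' (Eventually.of_forall fun _ => norm_nonneg _) ?_ hθ
    filter_upwards [eventually_ge_atTop 1] with n hn
    exact norm_chirpMean_sub_one_le hn _ _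
  have hnorm := hone.norm
  rw [norm_one] at hnorm
  have hrest : Tendsto (fun n => demod n (fun t => chirpSum C F t + w n t) (θ n)
      - C a₀ * chirpMean n (F a₀ - θ n)) atTop (𝓝 0) := by
    rw [tendsto_zero_iff_norm_tendsto_zero, Metric.tendsto_atTop']
    intro δ hδ
    have hT : 0 ≤ ∑ a, ‖C a‖ := by positivity
    obtain ⟨ε, hε0, hε1, hεδ⟩ : ∃ ε : ℝ, 0 < ε ∧ ε < 1 ∧ ((∑ a, ‖C a‖) + 1) * ε < δ := by
      refine ⟨min (1 / 2) (δ / (2 * ((∑ a, ‖C a‖) + 1))), by positivity,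
        (min_le_left _ _).trans_lt (by norm_num), ?_⟩
      calc _ ≤ ((∑ a, ‖C a‖) + 1) * (δ / (2 * ((∑ a, ‖C a‖) + 1))) := by
            gcongr; exact min_le_right _ _
        _ = δ / 2 := by field_simp
        _ < δ := by linarith
    have hev := ((eventually_forall_ne_norm_chirpMean_le hF hε0
      (hnorm.eventually_const_lt hε1)).and (hw ε hε0)).and hθU
    obtain ⟨N, hN⟩ := eventually_atTop.1 hev
    refine ⟨N, fun n hn => ?_⟩
    obtain ⟨⟨h1, h2⟩, h3⟩ := hN n hn.le
    rw [dist_zero_right, norm_norm, demod_add, demod_chirpSum, add_sub_right_comm]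
    refine (norm_add_le _ _).trans_lt ?_
    have h4 := norm_sum_mul_le_of_forall_ne C (fun a => chirpMean n (F a - θ n)) hε0.le h1
    have h5 := h2 _ h3
    linarith
  have := hrest.add (hone.const_mul (C a₀))
  simpa using this

/-- The demodulation peaks only near the frequency pair of a component that dominates the other
contributions. -/
theorem eventually_le_norm_chirpMean_of_le_norm_demod
    (hF : ∀ a b, a ≠ b → ¬ IsExceptional (F a - F b)) (hw : IsNegligibleOn U w)
    (hC : C a₀ ≠ 0) (ha₀ : F a₀ ∈ U) (hθU : ∀ᶠ n in atTop, θ n ∈ U)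
    (hmax : ∀ᶠ n in atTop, ‖demod n (fun t => chirpSum C F t + w n t) (F a₀)‖
      ≤ ‖demod n (fun t => chirpSum C F t + w n t) (θ n)‖)
    (hdom : ∀ a, a ≠ a₀ → ∃ m < ‖C a₀‖, ∀ᶠ n in atTop, ‖C a‖ * ‖chirpMean n (F a - θ n)‖ ≤ m)
    {κ : ℝ} (hκ : 0 < κ) :
    ∀ᶠ n in atTop, 1 - κ ≤ ‖chirpMean n (F a₀ - θ n)‖ := by
  obtain ⟨c, hc⟩ : ∃ c : ℝ, c = ‖C a₀‖ := ⟨_, rfl⟩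
  have hc0 : 0 < c := hc ▸ norm_pos_iff.2 hC
  obtain ⟨T, hT⟩ : ∃ T : ℝ, T = ∑ a, ‖C a‖ := ⟨_, rfl⟩
  have hT0 : 0 ≤ T := by rw [hT]; positivity
  rw [← hc] at hdom
  have hlim : Tendsto (fun n => demod n (fun t => chirpSum C F t + w n t) (F a₀)) atTop
      (𝓝 (C a₀)) :=
    tendsto_demod_of_tendsto_chirpDist (θ := fun _ => F a₀) hF hw
      (Eventually.of_forall fun _ => ha₀) (by simp [chirpDist])
  -- If only `b` can be visible, it must account for nearly the whole maximum. Of the error `(T + 2)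
  -- ε`, `T ε` comes from the other components, and one `ε` each from the negligible sequence and
  -- from the limit at `F a₀`.
  have hbound : ∀ ε > 0, ∀ᶠ n in atTop, ∀ b, (∀ a, a ≠ b → ‖chirpMean n (F a - θ n)‖ ≤ ε) →
      c ≤ ‖C b‖ * ‖chirpMean n (F b - θ n)‖ + (T + 2) * ε := by
    intro ε hε
    have hlim' := hlim.norm.eventually_const_le (sub_lt_self ‖C a₀‖ hε)
    filter_upwards [hlim', hmax, hw ε hε, hθU] with n h1 h2 h3 h4 b hb
    have h5 := norm_sum_mul_le_of_forall_ne C (fun a => chirpMean n (F a - θ n)) hε.le hb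
    have h6 := norm_sub_norm_le (∑ a, C a * chirpMean n (F a - θ n)) (C b * chirpMean n (F b - θ n))
    have h7 := norm_add_le (demod n (chirpSum C F) (θ n)) (demod n (w n) (θ n))
    have h8 := h3 _ h4
    rw [demod_add n _ _ (θ n)] at h2
    rw [demod_chirpSum] at h7 h2
    rw [norm_mul] at h6
    rw [← hT] at h5
    linarith
  -- the distances of the other contributions from the dominating coefficient
  have hgap : ∀ᶠ ε in 𝓝[>] (0 : ℝ), ∀ a, a ≠ a₀ →
      ∀ᶠ n in atTop, ‖C a‖ * ‖chirpMean n (F a - θ n)‖ + (T + 2) * ε < c := by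
    simp only [eventually_all]
    intro a ha
    obtain ⟨m, hm, hm'⟩ := hdom a ha
    have h0 : Tendsto (fun ε : ℝ => m + (T + 2) * ε) (𝓝[>] 0) (𝓝 m) := by
      have : Continuous fun ε : ℝ => m + (T + 2) * ε := by fun_prop
      simpa using (this.tendsto 0).mono_left nhdsWithin_le_nhds
    filter_upwards [h0.eventually_lt_const hm] with ε hε
    filter_upwards [hm'] with n hn
    linarith
  have hsmall : ∀ᶠ ε in 𝓝[>] (0 : ℝ), c * ε + (T + 2) * ε < c ∧ (T + 2) * ε < c * κ := by
    have h1 : Tendsto (fun ε : ℝ => c * ε + (T + 2) * ε) (𝓝[>] 0) (𝓝 0) := by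
      have : Continuous fun ε : ℝ => c * ε + (T + 2) * ε := by fun_prop
      simpa using (this.tendsto 0).mono_left nhdsWithin_le_nhds
    have h2 : Tendsto (fun ε : ℝ => (T + 2) * ε) (𝓝[>] 0) (𝓝 0) := by
      have : Continuous fun ε : ℝ => (T + 2) * ε := by fun_prop
      simpa using (this.tendsto 0).mono_left nhdsWithin_le_nhds
    exact (h1.eventually_lt_const hc0).and (h2.eventually_lt_const (by positivity))
  obtain ⟨ε, ⟨hε1, hε2, hε3⟩, hε0⟩ :=
    ((hgap.and hsmall).and self_mem_nhdsWithin).exists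
  have hε0 : 0 < ε := hε0
  have hgap' : ∀ᶠ n in atTop, ∀ a, a ≠ a₀ →
      ‖C a‖ * ‖chirpMean n (F a - θ n)‖ + (T + 2) * ε < c := by
    simpa only [eventually_all] using hε1
  filter_upwards [hgap', hbound ε hε0, eventually_all_ne_norm_chirpMean_le_or hF hε0]
    with n h1 h2 h3
  -- A visible `b ≠ a₀` would be the only visible component and would have to reach the level `c`,
  -- which domination excludes.
  have hbig : ∀ a, a ≠ a₀ → ‖chirpMean n (F a - θ n)‖ ≤ ε := by
    by_contra! hcon
    obtain ⟨b, hb, hb'⟩ := hcon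
    have := h2 b fun a ha => (h3 (θ n) a b ha).resolve_right (not_le.2 hb')
    exact absurd this (not_le.2 (h1 b hb))
  have h4 := h2 a₀ hbig
  rw [← hc] at h4
  by_contra! hcon
  nlinarith

end Peak

/-! ### Real chirps as pairs of complex chirps -/

/-- The coefficient `(A - i B) / 2` of `exp(i(θ₁ t + θ₂ t²))` in a chirp. -/
noncomputable def chirpCoeff (η : ChirpParam) : ℂ := (η.1.1 - η.1.2 * Complex.I) / 2

/-- The frequency pairs `θₖ` and `-θₖ` of the complex chirps that make up real chirps. -/
def pairFreq {p : ℕ} (θ : Fin p → ℝ × ℝ) (a : Fin p × Bool) : ℝ × ℝ :=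
  if a.2 then θ a.1 else -θ a.1

/-- The coefficients `cₖ` and their conjugates. -/
noncomputable def pairCoeff {p : ℕ} (c : Fin p → ℂ) (a : Fin p × Bool) : ℂ :=
  if a.2 then c a.1 else (starRingEnd ℂ) (c a.1)

theorem norm_pairCoeff {p : ℕ} (c : Fin p → ℂ) (a : Fin p × Bool) :
    ‖pairCoeff c a‖ = ‖c a.1‖ := by
  unfold pairCoeff
  split_ifs
  · rfl
  · exact RCLike.norm_conj _

theorem norm_chirpCoeff_sq (η : ChirpParam) : ‖chirpCoeff η‖ ^ 2 = chirpPower η / 4 := by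
  rw [← Complex.normSq_eq_norm_sq, Complex.normSq_apply]
  simp [chirpCoeff, chirpPower]
  ring

theorem chirp_eq_coeff (η : ChirpParam) (t : ℕ) :
    (chirp η t : ℂ) = chirpCoeff η * cis (chirpPhase η.2 t)
      + (starRingEnd ℂ) (chirpCoeff η) * cis (-chirpPhase η.2 t) := by
  rw [cis_eq_cos_add_sin, cis_eq_cos_add_sin]
  simp only [chirp, chirpCoeff, Real.cos_neg, Real.sin_neg, map_div₀, map_sub, map_mul,
    Complex.conj_ofReal, Complex.conj_I, map_ofNat, Complex.ofReal_add, Complex.ofReal_mul,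
    Complex.ofReal_neg]
  linear_combination ((η.1.2 : ℂ) * Real.sin (chirpPhase η.2 t)) * Complex.I_sq

theorem chirpSum_pair {p : ℕ} (c : Fin p → ℂ) (θ : Fin p → ℝ × ℝ) (t : ℕ) :
    chirpSum (pairCoeff c) (pairFreq θ) t
      = ∑ k, (c k * cis (chirpPhase (θ k) t)
        + (starRingEnd ℂ) (c k) * cis (-chirpPhase (θ k) t)) := by
  rw [chirpSum, Fintype.sum_prod_type]
  simp [pairCoeff, pairFreq, chirpPhase_neg]

/-- Differences of signed pairs are, up to sign, sums or differences of the `θₖ`. The sum `2 θₖ`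
separates a component from its own conjugate. -/
theorem IsNonresonant.pairFreq_sub {p : ℕ} {θ : Fin p → ℝ × ℝ} (h : IsNonresonant θ)
    (a b : Fin p × Bool) (hab : a ≠ b) : ¬ IsExceptional (pairFreq θ a - pairFreq θ b) := by
  obtain ⟨j, s⟩ := a
  obtain ⟨k, u⟩ := b
  intro hE
  cases s <;> cases u <;> simp only [pairFreq, Bool.false_eq_true, if_true, if_false] at hE
  · refine h.sub k j (fun hjk => hab (by rw [hjk])) ?_
    rwa [neg_sub_neg] at hE
  · refine h.add j k ?_
    have := hE.neg
    rwa [show -(-θ j - θ k) = θ j + θ k by abel] at this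
  · exact h.add j k (by rwa [sub_neg_eq_add] at hE)
  · exact h.sub j k (fun hjk => hab (by rw [hjk])) hE

/-! ### Periodogram and amplitude estimates in terms of the demodulation -/

theorem periodogram_eq_norm_demod {n : ℕ} (hn : 1 ≤ n) (y : ℕ → ℝ) (θ : ℝ × ℝ) :
    periodogram n y θ = 2 * n * ‖demod n (fun t => (y t : ℂ)) θ‖ ^ 2 := by
  have hn0 : (n : ℝ) ≠ 0 := by exact_mod_cast (by omega : n ≠ 0)
  have h : ∀ t, cis (-chirpPhase θ t) = Complex.exp (-(Complex.I * (chirpPhase θ t : ℂ))) :=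
    fun t => by simp [cis]
  simp only [periodogram, demod, h, norm_div, Complex.norm_natCast]
  field_simp

theorem norm_demod_le_of_isMaxOn {n : ℕ} (hn : 1 ≤ n) {y : ℕ → ℝ} {S : Set (ℝ × ℝ)}
    {θ θ' : ℝ × ℝ} (h : IsMaxOn (periodogram n y) S θ) (hθ' : θ' ∈ S) :
    ‖demod n (fun t => (y t : ℂ)) θ'‖ ≤ ‖demod n (fun t => (y t : ℂ)) θ‖ := by
  have h1 : periodogram n y θ' ≤ periodogram n y θ := h hθ'
  have hn0 : (0 : ℝ) < n := by exact_mod_cast hn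
  rw [periodogram_eq_norm_demod hn, periodogram_eq_norm_demod hn] at h1
  exact le_of_sq_le_sq (le_of_mul_le_mul_left h1 (by positivity)) (norm_nonneg _)

theorem amplitudeEstimate_eq_demod (n : ℕ) (y : ℕ → ℝ) (θ : ℝ × ℝ) :
    amplitudeEstimate n y θ = (2 * (demod n (fun t => (y t : ℂ)) θ).re,
      -2 * (demod n (fun t => (y t : ℂ)) θ).im) := by
  have h : demod n (fun t => (y t : ℂ)) θ
      = ((amplitudeEstimate n y θ).1 / 2 : ℝ)
        + ((-(amplitudeEstimate n y θ).2 / 2 : ℝ) : ℂ) * Complex.I := by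
    simp only [demod, amplitudeEstimate, cis_eq_cos_add_sin, Real.cos_neg, Real.sin_neg]
    push_cast
    rw [div_eq_inv_mul, Finset.mul_sum, Finset.mul_sum, Finset.mul_sum, neg_div, Finset.sum_div,
      Finset.sum_div, ← Finset.sum_neg_distrib, Finset.sum_mul, ← Finset.sum_add_distrib]
    refine Finset.sum_congr rfl fun t _ => ?_
    ring
  rw [h]
  ext
  · simp; ring
  · simp; ring

theorem tendsto_amplitudeEstimate {y : ℕ → ℕ → ℝ} {θ : ℕ → ℝ × ℝ} {η : ChirpParam}
    (h : Tendsto (fun n => demod n (fun t => (y n t : ℂ)) (θ n)) atTop (𝓝 (chirpCoeff η))) :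
    Tendsto (fun n => amplitudeEstimate n (y n) (θ n)) atTop (𝓝 η.1) := by
  simp only [amplitudeEstimate_eq_demod]
  have h1 := ((Complex.continuous_re.tendsto _).comp h).const_mul 2
  have h2 := ((Complex.continuous_im.tendsto _).comp h).const_mul (-2)
  have h3 := h1.prodMk_nhds h2
  have h4 : (2 * (chirpCoeff η).re, -2 * (chirpCoeff η).im) = η.1 := by
    ext
    · simp [chirpCoeff, mul_div_cancel₀]
    · simp [chirpCoeff, mul_div_cancel₀]
  rwa [h4] at h3

/-! ### Convergence of the frequency pairs -/

theorem tendsto_of_tendsto_chirpDist {θ : ℕ → ℝ × ℝ} {θ₀ : ℝ × ℝ}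
    (h : Tendsto (fun n => chirpDist n θ₀ (θ n)) atTop (𝓝 0)) : Tendsto θ atTop (𝓝 θ₀) := by
  rw [tendsto_iff_dist_tendsto_zero]
  refine squeeze_zero' (Eventually.of_forall fun _ => dist_nonneg) ?_ h
  filter_upwards [eventually_ge_atTop 1] with n hn
  have hn1 : (1 : ℝ) ≤ n := by exact_mod_cast hn
  rw [dist_comm, Prod.dist_eq, Real.dist_eq, Real.dist_eq, chirpDist]
  have h1 : |θ₀.1 - (θ n).1| ≤ |θ₀.1 - (θ n).1| * n := le_mul_of_one_le_right (abs_nonneg _) hn1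
  have h2 : |θ₀.2 - (θ n).2| ≤ |θ₀.2 - (θ n).2| * n ^ 2 :=
    le_mul_of_one_le_right (abs_nonneg _) (one_le_pow₀ hn1)
  refine max_le ?_ ?_ <;> nlinarith [abs_nonneg (θ₀.1 - (θ n).1), abs_nonneg (θ₀.2 - (θ n).2)]

/-- The hypotheses confine `x - y` to `(ρ - π, π - ρ)`, so nonzero multiples of `π` are farther than
`ρ` away. -/
theorem int_eq_zero_of_abs_sub_mul_pi_lt {x y ρ : ℝ} (hy : y ∈ Set.Ioo 0 Real.pi) {a : ℤ}
    (h1 : ρ ≤ x) (h2 : ρ ≤ Real.pi - x) (h : |x - y - a * Real.pi| < ρ) : a = 0 := by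
  have hpi := Real.pi_pos
  rw [abs_lt] at h
  obtain ⟨hy0, hy1⟩ := hy
  by_contra hne
  rcases lt_or_gt_of_ne hne with hlt | hgt
  · have : (a : ℝ) ≤ -1 := by exact_mod_cast (by omega : a ≤ -1)
    nlinarith
  · have : (1 : ℝ) ≤ a := by exact_mod_cast (by omega : 1 ≤ a)
    nlinarith

/-- In `(0, π) × (0, π)` a difference of frequency pairs gives a chirp with mean of modulus close
to one only if the pairs are close. -/
theorem tendsto_chirpDist_of_norm_chirpMean {θ : ℕ → ℝ × ℝ} {θ₀ : ℝ × ℝ}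
    (hθ₀ : θ₀ ∈ Set.Ioo 0 Real.pi ×ˢ Set.Ioo 0 Real.pi)
    (hθ : ∀ᶠ n in atTop, θ n ∈ Set.Ioo 0 Real.pi ×ˢ Set.Ioo 0 Real.pi)
    (h : ∀ κ > 0, ∀ᶠ n in atTop, 1 - κ ≤ ‖chirpMean n (θ₀ - θ n)‖) :
    Tendsto (fun n => chirpDist n θ₀ (θ n)) atTop (𝓝 0) := by
  rw [Metric.tendsto_atTop']
  intro δ hδ
  obtain ⟨⟨h1, h2⟩, h3, h4⟩ := hθ₀
  obtain ⟨ρ, hρ0, hρ1, hρ2, hρ3, hρ4, hρδ⟩ : ∃ ρ > 0, ρ ≤ θ₀.1 ∧ ρ ≤ Real.pi - θ₀.1 ∧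
      ρ ≤ θ₀.2 ∧ ρ ≤ Real.pi - θ₀.2 ∧ ρ ≤ δ := by
    have hev : ∀ c : ℝ, 0 < c → ∀ᶠ ρ in 𝓝[>] (0 : ℝ), ρ ≤ c := fun c hc =>
      nhdsWithin_le_nhds (eventually_le_nhds hc)
    obtain ⟨ρ, h5, h6, h7, h8, h9, h0⟩ := ((hev θ₀.1 h1).and
      ((hev (Real.pi - θ₀.1) (by linarith)).and
      ((hev θ₀.2 h3).and ((hev (Real.pi - θ₀.2) (by linarith)).and
      ((hev δ hδ).and self_mem_nhdsWithin))))).exists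
    exact ⟨ρ, h0, h5, h6, h7, h8, h9⟩
  obtain ⟨κ, hκ, hB⟩ := exists_abs_sub_mul_pi_le_of_norm_chirpMean
    (show 0 < ρ / 3 by positivity)
  obtain ⟨N, hN⟩ := eventually_atTop.1 (((h κ hκ).and hθ).and (eventually_ge_atTop 4))
  refine ⟨N, fun n hn => ?_⟩
  obtain ⟨⟨h5, h6⟩, h7⟩ := hN n hn.le
  have hn1 : (1 : ℝ) ≤ n := by exact_mod_cast (by omega : 1 ≤ n)
  obtain ⟨a, b, -, ha, hb⟩ := hB n h7 _ h5
  have ha0 : a = 0 := by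
    refine int_eq_zero_of_abs_sub_mul_pi_lt h6.1 hρ1 hρ2 ?_
    refine lt_of_le_of_lt ?_ (lt_of_le_of_lt ha (by linarith))
    exact le_mul_of_one_le_right (abs_nonneg _) hn1
  have hb0 : b = 0 := by
    refine int_eq_zero_of_abs_sub_mul_pi_lt h6.2 hρ3 hρ4 ?_
    refine lt_of_le_of_lt ?_ (lt_of_le_of_lt hb (by linarith))
    exact le_mul_of_one_le_right (abs_nonneg _) (one_le_pow₀ hn1)
  subst ha0 hb0
  simp only [Prod.fst_sub, Prod.snd_sub, Int.cast_zero, zero_mul, sub_zero] at ha hb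
  have hd : 0 ≤ chirpDist n θ₀ (θ n) := by unfold chirpDist; positivity
  rw [dist_zero_right, Real.norm_of_nonneg hd, chirpDist]
  linarith

/-- In an identifiable parameter space the conjugate of a component does not produce a peak. -/
theorem exists_forall_norm_chirpMean_conj_le {Θ : Set (ℝ × ℝ)} (hΘ : IsFrequencySpace Θ)
    {θ₀ : ℝ × ℝ} (hint : θ₀ ∈ interior Θ) (hres : ¬ IsExceptional (θ₀ + θ₀)) :
    ∃ m < 1, ∀ᶠ n in atTop, ∀ θ ∈ Θ, ‖chirpMean n (-θ₀ - θ)‖ ≤ m := by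
  have hpi := Real.pi_pos
  obtain ⟨⟨h1, h2⟩, h3, h4⟩ := hΘ.subset (interior_subset hint)
  -- The midpoint is the fixed point of the reflection, where a component and its conjugate coincide
  -- as chirps; nonresonance of `2 θ₀` excludes it.
  have hne : θ₀ ≠ (Real.pi / 2, Real.pi / 2) := by
    rintro rfl
    exact hres ⟨1, 1, by ext <;> simp⟩
  obtain ⟨ρ, hρ0, hρ1, hρ2, hρ3, hρ4, hρΘ, hρne⟩ : ∃ ρ > 0, ρ ≤ θ₀.1 ∧ ρ ≤ Real.pi - θ₀.1 ∧
      ρ ≤ θ₀.2 ∧ ρ ≤ Real.pi - θ₀.2 ∧ Metric.ball θ₀ ρ ⊆ Θ ∧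
      ρ ≤ dist θ₀ (Real.pi / 2, Real.pi / 2) := by
    have hev : ∀ c : ℝ, 0 < c → ∀ᶠ ρ in 𝓝[>] (0 : ℝ), ρ ≤ c := fun c hc =>
      nhdsWithin_le_nhds (eventually_le_nhds hc)
    obtain ⟨ε, hε, hball⟩ := Metric.isOpen_iff.1 isOpen_interior θ₀ hint
    obtain ⟨ρ, h5, h6, h7, h8, h9, h10, h0⟩ := ((hev θ₀.1 h1).and
      ((hev (Real.pi - θ₀.1) (by linarith)).and
      ((hev θ₀.2 h3).and ((hev (Real.pi - θ₀.2) (by linarith)).and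
      ((hev ε hε).and ((hev _ (dist_pos.2 hne)).and self_mem_nhdsWithin)))))).exists
    exact ⟨ρ, h0, h5, h6, h7, h8,
      (Metric.ball_subset_ball h9).trans (hball.trans interior_subset), h10⟩
  obtain ⟨κ, hκ, hB⟩ := exists_abs_sub_mul_pi_le_of_norm_chirpMean
    (show 0 < ρ / 2 by positivity)
  refine ⟨1 - κ, by linarith, ?_⟩
  filter_upwards [eventually_ge_atTop 4] with n hn θ hθ
  by_contra! hcon
  have hn1 : (1 : ℝ) ≤ n := by exact_mod_cast (by omega : 1 ≤ n)
  rw [show -θ₀ - θ = -(θ₀ + θ) by abel, norm_chirpMean_neg] at hcon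
  obtain ⟨a, b, -, ha, hb⟩ := hB n hn _ hcon.le
  have ha' : |(θ₀ + θ).1 - a * Real.pi| < ρ :=
    (le_mul_of_one_le_right (abs_nonneg _) hn1).trans_lt (ha.trans_lt (by linarith))
  have hb' : |(θ₀ + θ).2 - b * Real.pi| < ρ :=
    (le_mul_of_one_le_right (abs_nonneg _) (one_le_pow₀ hn1)).trans_lt (hb.trans_lt (by linarith))
  have hθ' := hΘ.subset hθ
  have hreflect : ∀ (x y : ℝ) (a : ℤ), y ∈ Set.Ioo 0 Real.pi → ρ ≤ x → ρ ≤ Real.pi - x →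
      |x + y - a * Real.pi| < ρ → dist (Real.pi - y) x < ρ := by
    intro x y a hy hx hx' hxy
    have hy' : Real.pi - y ∈ Set.Ioo 0 Real.pi := ⟨by linarith [hy.2], by linarith [hy.1]⟩
    have h5 : |x - (Real.pi - y) - (a - 1 : ℤ) * Real.pi| < ρ := by
      convert hxy using 2
      push_cast; ring
    have h6 := int_eq_zero_of_abs_sub_mul_pi_lt hy' hx hx' h5
    rw [h6, Int.cast_zero, zero_mul, sub_zero] at h5
    rwa [dist_comm, Real.dist_eq]
  have hclose : dist (chirpReflect θ) θ₀ < ρ := by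
    rw [Prod.dist_eq, max_lt_iff]
    exact ⟨hreflect _ _ a hθ'.1 hρ1 hρ2 ha', hreflect _ _ b hθ'.2 hρ3 hρ4 hb'⟩
  -- A peak of the conjugate at `θ` puts the reflection of `θ` in a ball about `θ₀` inside `Θ`.
  -- Identifiability then makes `θ` the midpoint, which `ρ` was chosen to keep outside that ball.
  have hfix := hΘ.identifiable θ hθ (hρΘ hclose)
  have hmid : chirpReflect θ = (Real.pi / 2, Real.pi / 2) := by
    rw [hfix]
    have h5 := congrArg Prod.fst hfix
    have h6 := congrArg Prod.snd hfix
    simp only [chirpReflect] at h5 h6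
    ext
    · simp only; linarith
    · simp only; linarith
  rw [hmid, dist_comm] at hclose
  linarith

/-! ### Removal of estimated components -/

theorem abs_chirp_sub_chirp_le {n t : ℕ} (ht : t ≤ n) (η η' : ChirpParam) :
    |chirp η t - chirp η' t| ≤ |η.1.1 - η'.1.1| + |η.1.2 - η'.1.2|
      + (|η.1.1| + |η.1.2|) * chirpDist n η.2 η'.2 := by
  have hφ := abs_chirpPhase_sub_le ht η.2 η'.2
  have hcos : |Real.cos (chirpPhase η.2 t) - Real.cos (chirpPhase η'.2 t)|
      ≤ chirpDist n η.2 η'.2 := by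
    have h1 := Complex.abs_re_le_norm (cis (chirpPhase η.2 t) - cis (chirpPhase η'.2 t))
    rw [Complex.sub_re, cis_re, cis_re] at h1
    exact h1.trans ((norm_cis_sub_cis_le _ _).trans hφ)
  have hsin : |Real.sin (chirpPhase η.2 t) - Real.sin (chirpPhase η'.2 t)|
      ≤ chirpDist n η.2 η'.2 := by
    have h1 := Complex.abs_im_le_norm (cis (chirpPhase η.2 t) - cis (chirpPhase η'.2 t))
    rw [Complex.sub_im, cis_im, cis_im] at h1
    exact h1.trans ((norm_cis_sub_cis_le _ _).trans hφ)
  have heq : chirp η t - chirp η' t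
      = (η.1.1 - η'.1.1) * Real.cos (chirpPhase η'.2 t)
        + (η.1.2 - η'.1.2) * Real.sin (chirpPhase η'.2 t)
        + (η.1.1 * (Real.cos (chirpPhase η.2 t) - Real.cos (chirpPhase η'.2 t))
        + η.1.2 * (Real.sin (chirpPhase η.2 t) - Real.sin (chirpPhase η'.2 t))) := by
    simp only [chirp]; ring
  rw [heq, add_mul]
  refine (abs_add_le _ _).trans (add_le_add ((abs_add_le _ _).trans (add_le_add ?_ ?_))
    ((abs_add_le _ _).trans (add_le_add ?_ ?_)))
  · rw [abs_mul]
    exact mul_le_of_le_one_right (abs_nonneg _) (Real.abs_cos_le_one _)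
  · rw [abs_mul]
    exact mul_le_of_le_one_right (abs_nonneg _) (Real.abs_sin_le_one _)
  · rw [abs_mul]; gcongr
  · rw [abs_mul]; gcongr

/-- `chirpDist` bounds the phase error at all times `t ≤ n` at once, so the two chirps agree
uniformly up to `o(1)`. Mere convergence of the frequency pairs would not give this. -/
theorem isNegligibleOn_chirp_sub {U : Set (ℝ × ℝ)} {η : ℕ → ChirpParam} {η₀ : ChirpParam}
    (h1 : Tendsto (fun n => (η n).1) atTop (𝓝 η₀.1))
    (h2 : Tendsto (fun n => chirpDist n η₀.2 (η n).2) atTop (𝓝 0)) :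
    IsNegligibleOn U fun n t => ((chirp η₀ t - chirp (η n) t : ℝ) : ℂ) := by
  have hlim : Tendsto (fun n => |η₀.1.1 - (η n).1.1| + |η₀.1.2 - (η n).1.2|
      + (|η₀.1.1| + |η₀.1.2|) * chirpDist n η₀.2 (η n).2) atTop (𝓝 0) := by
    have h3 : Tendsto (fun n => (η n).1.1) atTop (𝓝 η₀.1.1) :=
      (continuous_fst.tendsto _).comp h1
    have h4 : Tendsto (fun n => (η n).1.2) atTop (𝓝 η₀.1.2) :=
      (continuous_snd.tendsto _).comp h1
    have h5 := ((h3.const_sub η₀.1.1).abs.add (h4.const_sub η₀.1.2).abs).add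
      (h2.const_mul (|η₀.1.1| + |η₀.1.2|))
    simpa using h5
  intro ε hε
  filter_upwards [hlim.eventually_le_const hε] with n hn θ _
  refine norm_demod_le_of_forall_le hε.le (fun t ht => ?_) θ
  rw [Complex.norm_real]
  exact (abs_chirp_sub_chirp_le ht _ _).trans hn

theorem IsNegligibleOn.add {U : Set (ℝ × ℝ)} {w w' : ℕ → ℕ → ℂ} (h : IsNegligibleOn U w)
    (h' : IsNegligibleOn U w') : IsNegligibleOn U fun n t => w n t + w' n t := by
  intro ε hε
  filter_upwards [h (ε / 2) (by positivity), h' (ε / 2) (by positivity)] with n h1 h2 θ hθ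
  rw [demod_add n (w n) (w' n)]
  refine (norm_add_le _ _).trans ?_
  linarith [h1 θ hθ, h2 θ hθ]

theorem isNegligibleOn_zero (U : Set (ℝ × ℝ)) : IsNegligibleOn U fun _ _ => 0 := by
  intro ε hε
  exact Eventually.of_forall fun n θ _ => by simp [demod, hε.le]

theorem IsNegligibleOn.sum {U : Set (ℝ × ℝ)} {ι : Type*} (s : Finset ι) {w : ι → ℕ → ℕ → ℂ}
    (h : ∀ i ∈ s, IsNegligibleOn U (w i)) : IsNegligibleOn U fun n t => ∑ i ∈ s, w i n t := by
  classical
  induction s using Finset.induction_on with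
  | empty => simpa using isNegligibleOn_zero U
  | insert i s hi ih =>
    simp only [Finset.sum_insert hi]
    exact (h i (Finset.mem_insert_self _ _)).add
      (ih fun j hj => h j (Finset.mem_insert_of_mem hj))

/-! ### Uniform negligibility of the noise -/

theorem sum_Icc_one_eq_sum_range {E : Type*} [AddCommMonoid E] (f : ℕ → E) (n : ℕ) :
    ∑ t ∈ Finset.Icc 1 n, f t = ∑ t ∈ Finset.range n, f (t + 1) := by
  induction n with
  | zero => simp
  | succ n ih => rw [Finset.sum_Icc_succ_top (by omega), Finset.sum_range_succ, ih]

theorem norm_demod_le_sum_div (n : ℕ) (z : ℕ → ℂ) (θ : ℝ × ℝ) :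
    ‖demod n z θ‖ ≤ (∑ t ∈ Finset.Icc 1 n, ‖z t‖) / n := by
  rw [demod, norm_div, Complex.norm_natCast]
  gcongr
  refine norm_sum_le_of_le _ fun t _ => ?_
  rw [norm_mul, norm_cis, mul_one]

theorem norm_demod_sub_demod_le {n : ℕ} {z : ℕ → ℂ} {M : ℝ} (hM : 0 ≤ M) (hz : ∀ t ≤ n, ‖z t‖ ≤ M)
    (θ θ' : ℝ × ℝ) : ‖demod n z θ - demod n z θ'‖ ≤ M * chirpDist n θ θ' := by
  have hd : 0 ≤ chirpDist n θ θ' := by unfold chirpDist; positivity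
  have h : demod n z θ - demod n z θ'
      = demod n (fun t => z t * (cis (-chirpPhase θ t) - cis (-chirpPhase θ' t))) 0 := by
    have h0 : ∀ t, cis (-chirpPhase 0 t) = 1 := fun t => by simp [chirpPhase, cis_zero]
    simp only [demod, h0, mul_one, mul_sub, Finset.sum_sub_distrib, sub_div]
  rw [h]
  refine norm_demod_le_of_forall_le (by positivity) (fun t ht => ?_) 0
  rw [norm_mul]
  have h1 := norm_cis_sub_cis_le (-chirpPhase θ t) (-chirpPhase θ' t)
  rw [neg_sub_neg, abs_sub_comm] at h1
  exact mul_le_mul (hz t ht) (h1.trans (abs_chirpPhase_sub_le ht θ θ')) (norm_nonneg _) hM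

/-- The four real weights `± cos` and `± sin` of the phase. -/
noncomputable def phaseWeight (s : Bool × Bool) (θ : ℝ × ℝ) (t : ℕ) : ℝ :=
  (if s.1 then 1 else -1) *
    (if s.2 then Real.cos (chirpPhase θ t) else Real.sin (chirpPhase θ t))

theorem abs_phaseWeight_le_one (s : Bool × Bool) (θ : ℝ × ℝ) (t : ℕ) :
    |phaseWeight s θ t| ≤ 1 := by
  obtain ⟨s1, s2⟩ := s
  cases s1 <;> cases s2 <;>
    simp [phaseWeight, Real.abs_cos_le_one, Real.abs_sin_le_one]

/-- Reduces a complex modulus to four one-sided inequalities, the form in which the tail bound for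
real sums is applied. -/
theorem norm_demod_le_of_phaseWeight {n : ℕ} (hn : 1 ≤ n) {x : ℕ → ℝ} {θ : ℝ × ℝ} {ε : ℝ}
    (h : ∀ s, ∑ t ∈ Finset.range n, phaseWeight s θ (t + 1) * x (t + 1) < n * ε) :
    ‖demod n (fun t => (x t : ℂ)) θ‖ ≤ 2 * ε := by
  have hn0 : (0 : ℝ) < n := by exact_mod_cast hn
  have h' : ∀ s, ∑ t ∈ Finset.Icc 1 n, phaseWeight s θ t * x t < n * ε := fun s => by
    rw [sum_Icc_one_eq_sum_range]; exact h s
  have h1 := h' (true, true)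
  have h2 := h' (true, false)
  have h3 := h' (false, true)
  have h4 := h' (false, false)
  simp only [phaseWeight, if_true, Bool.false_eq_true, if_false, one_mul, neg_mul,
    Finset.sum_neg_distrib] at h1 h2 h3 h4
  set S := ∑ t ∈ Finset.Icc 1 n, (x t : ℂ) * cis (-chirpPhase θ t) with hS
  have hre : S.re = ∑ t ∈ Finset.Icc 1 n, Real.cos (chirpPhase θ t) * x t := by
    rw [hS, Complex.re_sum]
    refine Finset.sum_congr rfl fun t _ => ?_
    rw [Complex.re_ofReal_mul, cis_re, Real.cos_neg, mul_comm]
  have him : S.im = -∑ t ∈ Finset.Icc 1 n, Real.sin (chirpPhase θ t) * x t := by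
    rw [hS, Complex.im_sum, ← Finset.sum_neg_distrib]
    refine Finset.sum_congr rfl fun t _ => ?_
    rw [Complex.im_ofReal_mul, cis_im, Real.sin_neg]
    ring
  have hnorm := Complex.norm_le_abs_re_add_abs_im S
  have h5 : |S.re| ≤ n * ε := by rw [hre, abs_le]; constructor <;> linarith
  have h6 : |S.im| ≤ n * ε := by rw [him, abs_le]; constructor <;> linarith
  rw [demod, ← hS, norm_div, Complex.norm_natCast, div_le_iff₀ hn0]
  linarith

/-- A grid point of mesh `n⁻³`. -/
noncomputable def chirpGrid (n : ℕ) (g : ℕ × ℕ) : ℝ × ℝ := ((g.1 : ℝ) / n ^ 3, (g.2 : ℝ) / n ^ 3)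

theorem exists_chirpGrid_chirpDist_le {n : ℕ} (hn : 1 ≤ n) {θ : ℝ × ℝ}
    (hθ : θ ∈ Set.Ioo 0 Real.pi ×ˢ Set.Ioo 0 Real.pi) :
    ∃ g ∈ Finset.range (4 * n ^ 3 + 1) ×ˢ Finset.range (4 * n ^ 3 + 1),
      chirpDist n θ (chirpGrid n g) ≤ 2 / n := by
  have hn0 : (0 : ℝ) < n := by exact_mod_cast hn
  have hn1 : (1 : ℝ) ≤ n := by exact_mod_cast hn
  have key : ∀ x : ℝ, x ∈ Set.Ioo 0 Real.pi → ∃ i ∈ Finset.range (4 * n ^ 3 + 1),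
      |x - (i : ℝ) / n ^ 3| ≤ 1 / n ^ 3 := by
    intro x hx
    have hx0 : 0 ≤ x * n ^ 3 := by have := hx.1; positivity
    refine ⟨⌊x * n ^ 3⌋₊, ?_, ?_⟩
    · rw [Finset.mem_range, Nat.lt_succ_iff]
      refine Nat.floor_le_of_le ?_
      push_cast
      have := hx.2.le.trans Real.pi_le_four
      gcongr
    · have h1 := Nat.floor_le hx0
      have h2 := Nat.lt_floor_add_one (x * n ^ 3)
      have h3 : x - (⌊x * n ^ 3⌋₊ : ℝ) / n ^ 3 = (x * n ^ 3 - ⌊x * n ^ 3⌋₊) / n ^ 3 := by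
        field_simp
      rw [h3, abs_div, abs_of_nonneg (by positivity : (0 : ℝ) ≤ (n : ℝ) ^ 3)]
      gcongr
      rw [abs_le]
      constructor <;> linarith
  obtain ⟨i, hi, hi'⟩ := key _ hθ.1
  obtain ⟨j, hj, hj'⟩ := key _ hθ.2
  refine ⟨(i, j), Finset.mk_mem_product hi hj, ?_⟩
  -- The mesh `n⁻³` beats the factor `n²` of the rate, while the number of grid points stays
  -- polynomial in `n`.
  calc chirpDist n θ (chirpGrid n (i, j)) ≤ 1 / n ^ 3 * n + 1 / n ^ 3 * n ^ 2 := by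
        unfold chirpDist chirpGrid
        gcongr
    _ = 1 / n * (1 / n) + 1 / n := by field_simp
    _ ≤ 1 * (1 / n) + 1 / n := by
        gcongr
        exact div_le_one_of_le₀ hn1 hn0.le
    _ = 2 / n := by ring

section Noise

variable {Ω : Type*} [MeasurableSpace Ω] {P : Measure Ω}

/-- Truncation at the levels `± M`. -/
noncomputable def clip (M x : ℝ) : ℝ := max (-M) (min x M)

theorem measurable_clip (M : ℝ) : Measurable (clip M) := by
  unfold clip; fun_prop

theorem abs_clip_le {M : ℝ} (hM : 0 ≤ M) (x : ℝ) : |clip M x| ≤ M :=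
  abs_le.2 ⟨le_max_left _ _, max_le (by linarith) (min_le_right _ _)⟩

theorem clip_eq_self {M x : ℝ} (h : |x| ≤ M) : clip M x = x := by
  obtain ⟨h1, h2⟩ := abs_le.1 h
  rw [clip, min_eq_left h2, max_eq_right h1]

theorem abs_sub_clip_le {M : ℝ} (hM : 0 ≤ M) (x : ℝ) : |x - clip M x| ≤ |x| := by
  unfold clip
  rcases max_cases (-M) (min x M) with h | h <;> rcases min_cases x M with h' | h' <;>
    rw [abs_le] <;> constructor <;> cases abs_cases x <;> linarith

theorem tendsto_integral_abs_sub_clip {Z : Ω → ℝ} (hZ : Integrable Z P) :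
    Tendsto (fun M : ℕ => ∫ ω, |Z ω - clip M (Z ω)| ∂P) atTop (𝓝 0) := by
  have h := tendsto_integral_of_dominated_convergence (μ := P)
    (F := fun (M : ℕ) ω => |Z ω - clip M (Z ω)|) (f := fun _ => 0) (fun ω => |Z ω|)
    (fun M => ((hZ.aemeasurable.sub
      ((measurable_clip M).comp_aemeasurable hZ.aemeasurable)).abs).aestronglyMeasurable)
    hZ.abs
    (fun M => Eventually.of_forall fun ω => by
      rw [Real.norm_eq_abs, abs_abs]
      exact abs_sub_clip_le (Nat.cast_nonneg M) _)
    (Eventually.of_forall fun ω => by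
      obtain ⟨N, hN⟩ := exists_nat_ge |Z ω|
      refine tendsto_const_nhds.congr' ?_
      filter_upwards [eventually_ge_atTop N] with M hM
      have : (N : ℝ) ≤ M := by exact_mod_cast hM
      rw [clip_eq_self (hN.trans this), sub_self, abs_zero])
  simpa using h

variable [IsProbabilityMeasure P]

/-- Hoeffding's inequality: each summand lies in `[-M, M]`, hence is sub-Gaussian with variance
proxy `M²`. -/
theorem measure_weighted_sum_ge_le {X : ℕ → Ω → ℝ} {M : ℝ} (hM : 0 < M) (hind : iIndepFun X P)
    (hmeas : ∀ t, AEMeasurable (X t) P) (hbdd : ∀ t ω, |X t ω| ≤ M) (hmean : ∀ t, ∫ ω, X t ω ∂P = 0)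
    {c : ℕ → ℝ} (hc : ∀ t, |c t| ≤ 1) {n : ℕ} {ε : ℝ} (hε : 0 ≤ ε) :
    P {ω | n * ε ≤ ∑ t ∈ Finset.range n, c t * X t ω}
      ≤ ENNReal.ofReal (Real.exp (-(ε ^ 2 / (2 * M ^ 2)) * n)) := by
  have hsub : ∀ t ∈ Finset.range n,
      HasSubgaussianMGF (fun ω => c t * X t ω) (Real.toNNReal M ^ 2) P := by
    intro t _
    have h1 := hasSubgaussianMGF_of_mem_Icc (μ := P) (X := fun ω => c t * X t ω) (a := -M) (b := M)
      ((hmeas t).const_mul _) (Eventually.of_forall fun ω => by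
        have h2 : |c t * X t ω| ≤ M := by
          rw [abs_mul]
          exact (mul_le_of_le_one_left (abs_nonneg _) (hc t)).trans (hbdd t ω)
        exact abs_le.1 h2)
    have h3 : (‖M - -M‖₊ / 2) ^ 2 = Real.toNNReal M ^ 2 := by
      congr 1
      ext
      simp only [NNReal.coe_div, coe_nnnorm, NNReal.coe_ofNat, Real.coe_toNNReal _ hM.le,
        Real.norm_eq_abs]
      rw [sub_neg_eq_add, abs_of_pos (by positivity)]
      ring
    rw [h3] at h1
    simpa [integral_const_mul, hmean] using h1
  have hind' : iIndepFun (fun t ω => c t * X t ω) P :=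
    hind.comp (fun t x => c t * x) fun t => measurable_const_mul _
  have h := HasSubgaussianMGF.measure_sum_ge_le_of_iIndepFun hind' hsub
    (ε := n * ε) (by positivity)
  rw [← ofReal_measureReal]
  refine ENNReal.ofReal_le_ofReal (h.trans (Real.exp_le_exp.2 (le_of_eq ?_)))
  rcases Nat.eq_zero_or_pos n with rfl | hn
  · simp
  have hn0 : (n : ℝ) ≠ 0 := by exact_mod_cast hn.ne'
  simp only [Finset.sum_const, Finset.card_range, nsmul_eq_mul, NNReal.coe_mul,
    NNReal.coe_natCast, NNReal.coe_pow, Real.coe_toNNReal _ hM.le]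
  field_simp

/-- A union bound over the grid costs a factor of order `n⁶` against exponentially small tails, so
Borel–Cantelli applies. Between grid points the demodulation varies by at most `2 M / n`. -/
theorem ae_eventually_norm_demod_le_of_bounded {X : ℕ → Ω → ℝ} {M : ℝ} (hM : 0 < M)
    (hind : iIndepFun (fun t => X (t + 1)) P) (hmeas : ∀ t, AEMeasurable (X (t + 1)) P)
    (hbdd : ∀ t ω, |X t ω| ≤ M) (hmean : ∀ t, ∫ ω, X (t + 1) ω ∂P = 0) {ε : ℝ} (hε : 0 < ε) :
    ∀ᵐ ω ∂P, ∀ᶠ n in atTop, ∀ θ ∈ Set.Ioo 0 Real.pi ×ˢ Set.Ioo 0 Real.pi,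
      ‖demod n (fun t => (X t ω : ℂ)) θ‖ ≤ 3 * ε := by
  set r : ℝ := ε ^ 2 / (2 * M ^ 2) with hr
  have hr0 : 0 < r := by positivity
  set G : ℕ → Finset ((ℕ × ℕ) × Bool × Bool) := fun n =>
    (Finset.range (4 * n ^ 3 + 1) ×ˢ Finset.range (4 * n ^ 3 + 1)) ×ˢ Finset.univ with hG
  set bad : ℕ → Set Ω := fun n => ⋃ g ∈ G n, {ω | n * ε ≤
    ∑ t ∈ Finset.range n, phaseWeight g.2 (chirpGrid n g.1) (t + 1) * X (t + 1) ω} with hbad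
  have hbadle : ∀ n, P (bad n) ≤ ENNReal.ofReal
      (4 * (4 * n ^ 3 + 1) ^ 2 * Real.exp (-r * n)) := by
    intro n
    refine (measure_biUnion_finset_le _ _).trans ?_
    refine (Finset.sum_le_sum fun g _ => measure_weighted_sum_ge_le hM hind hmeas
      (fun t ω => hbdd (t + 1) ω) hmean (c := fun t => phaseWeight g.2 (chirpGrid n g.1) (t + 1))
      (fun t => abs_phaseWeight_le_one _ _ _) hε.le).trans (le_of_eq ?_)
    rw [Finset.sum_const, nsmul_eq_mul, ← ENNReal.ofReal_natCast,
      ← ENNReal.ofReal_mul (by positivity)]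
    congr 2
    simp [hG]
    ring
  have hsum : Summable fun n : ℕ => 4 * (4 * (n : ℝ) ^ 3 + 1) ^ 2 * Real.exp (-r * n) := by
    have h6 := (Real.summable_pow_mul_exp_neg_nat_mul 6 hr0).mul_left 64
    have h3 := (Real.summable_pow_mul_exp_neg_nat_mul 3 hr0).mul_left 32
    have h0 := (Real.summable_pow_mul_exp_neg_nat_mul 0 hr0).mul_left 4
    refine ((h6.add h3).add h0).congr fun n => ?_
    ring
  have hfin : ∑' n, P (bad n) ≠ ⊤ :=
    ne_top_of_le_ne_top hsum.tsum_ofReal_ne_top (ENNReal.tsum_le_tsum hbadle)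
  obtain ⟨N, hN⟩ := exists_nat_gt (2 * M / ε)
  filter_upwards [ae_eventually_notMem hfin] with ω hω
  filter_upwards [hω, eventually_ge_atTop N, eventually_ge_atTop 1] with n hn hnN hn1 θ hθ
  have hn0 : (0 : ℝ) < n := by exact_mod_cast hn1
  obtain ⟨g, hg, hgθ⟩ := exists_chirpGrid_chirpDist_le hn1 hθ
  have hgood : ‖demod n (fun t => (X t ω : ℂ)) (chirpGrid n g)‖ ≤ 2 * ε := by
    refine norm_demod_le_of_phaseWeight hn1 fun s => ?_
    by_contra! hcon
    exact hn (Set.mem_biUnion (x := (g, s))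
      (Finset.mem_product.2 ⟨hg, Finset.mem_univ _⟩) hcon)
  have hdiff := norm_demod_sub_demod_le hM.le (n := n) (z := fun t => (X t ω : ℂ))
    (fun t _ => by rw [Complex.norm_real]; exact hbdd t ω) θ (chirpGrid n g)
  have hsmall : M * chirpDist n θ (chirpGrid n g) ≤ ε := by
    have hNn : (N : ℝ) ≤ n := by exact_mod_cast hnN
    rw [div_lt_iff₀ hε] at hN
    calc _ ≤ M * (2 / n) := by gcongr
      _ = 2 * M / n := by ring
      _ ≤ ε := by rw [div_le_iff₀ hn0]; nlinarith
  have := norm_sub_norm_le (demod n (fun t => (X t ω : ℂ)) θ)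
    (demod n (fun t => (X t ω : ℂ)) (chirpGrid n g))
  linarith

variable {δ : ℝ} {e : ℕ → Ω → ℝ}

theorem IsErrorProcess.integrable (he : IsErrorProcess P δ e) : Integrable (e 1) P := by
  have h1 := (he.ident 1 le_rfl).aemeasurable_fst
  refine Integrable.mono' ((integrable_const 1).add he.moment) h1.aestronglyMeasurable
    (Eventually.of_forall fun ω => ?_)
  simp only [Pi.add_apply, Real.norm_eq_abs]
  have hδ := he.delta_pos
  rcases le_total |e 1 ω| 1 with h | h
  · have : 0 ≤ |e 1 ω| ^ (1 + δ) := by positivity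
    linarith
  · have : |e 1 ω| ^ (1 : ℝ) ≤ |e 1 ω| ^ (1 + δ) :=
      Real.rpow_le_rpow_of_exponent_le h (by linarith)
    rw [Real.rpow_one] at this
    linarith

/-- The demodulation of the noise tends to zero uniformly in the frequency pair. -/
theorem IsErrorProcess.ae_isNegligibleOn (he : IsErrorProcess P δ e) :
    ∀ᵐ ω ∂P, IsNegligibleOn (Set.Ioo 0 Real.pi ×ˢ Set.Ioo 0 Real.pi)
      fun _ t => (e t ω : ℂ) := by
  have hint := he.integrable
  have hmeas : ∀ t, AEMeasurable (e (t + 1)) P := fun t =>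
    (he.ident (t + 1) (by omega)).aemeasurable_fst
  set a : ℕ → ℝ := fun M => ∫ ω, clip M (e 1 ω) ∂P with ha
  set τ : ℕ → ℝ := fun M => ∫ ω, |e 1 ω - clip M (e 1 ω)| ∂P with hτ
  have hclipint : ∀ M : ℕ, Integrable (fun ω => clip M (e 1 ω)) P := fun M =>
    Integrable.of_bound ((measurable_clip M).comp_aemeasurable (hmeas 0)).aestronglyMeasurable M
      (Eventually.of_forall fun ω => abs_clip_le (Nat.cast_nonneg M) _)
  -- The centring constant of the truncated error is minus the mean of the discarded tail, because
  -- the error itself has mean zero.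
  have haτ : ∀ M, |a M| ≤ τ M := by
    intro M
    have h1 : a M = -∫ ω, (e 1 ω - clip M (e 1 ω)) ∂P := by
      rw [integral_sub hint (hclipint M), he.mean_zero]
      ring
    rw [h1, abs_neg]
    exact abs_integral_le_integral_abs
  -- Truncation levels and tolerances run through countable sets so that one null set serves for all
  -- of them.
  have hbounded : ∀ᵐ ω ∂P, ∀ M k : ℕ, ∀ᶠ n in atTop,
      ∀ θ ∈ Set.Ioo 0 Real.pi ×ˢ Set.Ioo 0 Real.pi,
        ‖demod n (fun t => ((clip M (e t ω) - a M : ℝ) : ℂ)) θ‖ ≤ 3 * (1 / (k + 1)) := by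
    rw [ae_all_iff]
    intro M
    rw [ae_all_iff]
    intro k
    have haM : |a M| ≤ M := by
      have := norm_integral_le_of_norm_le_const (μ := P) (f := fun ω => clip M (e 1 ω)) (C := M)
        (Eventually.of_forall fun ω => abs_clip_le (Nat.cast_nonneg M) _)
      simpa using this
    -- The centred truncation is bounded by `2 M`; adding one keeps the bound positive at level
    -- zero.
    refine ae_eventually_norm_demod_le_of_bounded (X := fun t ω => clip M (e t ω) - a M)
      (M := 2 * M + 1) (by positivity)
      (he.indep.comp (fun _ x => clip M x - a M) fun _ => (measurable_clip M).sub_const _)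
      (fun t => ((measurable_clip M).comp_aemeasurable (hmeas t)).sub_const _)
      (fun t ω => ?_) (fun t => ?_) (by positivity)
    · have h1 := abs_sub (clip M (e t ω)) (a M)
      have h2 := abs_clip_le (Nat.cast_nonneg M) (e t ω)
      linarith
    · have hid : IdentDistrib (fun ω => clip M (e (t + 1) ω)) (fun ω => clip M (e 1 ω)) P P :=
        (he.ident (t + 1) (by omega)).comp (measurable_clip M)
      rw [integral_sub (hid.integrable_iff.2 (hclipint M)) (integrable_const _),
        hid.integral_eq, integral_const]
      simp [ha]
  -- The tails are controlled in absolute mean, a bound free of the frequency pair and therefore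
  -- uniform in it.
  have hslln : ∀ᵐ ω ∂P, ∀ M : ℕ, Tendsto (fun n : ℕ =>
      (∑ i ∈ Finset.range n, |e (i + 1) ω - clip M (e (i + 1) ω)|) / n) atTop (𝓝 (τ M)) := by
    rw [ae_all_iff]
    intro M
    have hu : Measurable fun x : ℝ => |x - clip M x| := (measurable_id.sub (measurable_clip M)).abs
    refine strong_law_ae_real (fun i ω => |e (i + 1) ω - clip M (e (i + 1) ω)|)
      (hint.sub (hclipint M)).abs (fun i j hij => ?_)
      (fun i => (he.ident (i + 1) (by omega)).comp hu)
    exact (he.indep.indepFun hij).comp hu hu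
  filter_upwards [hbounded, hslln] with ω h1 h2 ε hε
  obtain ⟨M, hM⟩ := ((tendsto_integral_abs_sub_clip hint).eventually_lt_const
    (show 0 < ε / 8 by positivity)).exists
  obtain ⟨k, hk⟩ := exists_nat_one_div_lt (show 0 < ε / 6 by positivity)
  filter_upwards [h1 M k, (h2 M).eventually_lt_const (show τ M < ε / 4 by
    have : τ M < ε / 8 := hM
    linarith), eventually_ge_atTop 1] with n h3 h4 hn θ hθ
  have hn0 : (n : ℝ) ≠ 0 := by exact_mod_cast (by omega : n ≠ 0)
  have h5 := h3 θ hθ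
  have hsplit : (fun t => (e t ω : ℂ)) = fun t => ((clip M (e t ω) - a M : ℝ) : ℂ)
      + ((e t ω - clip M (e t ω) + a M : ℝ) : ℂ) := by
    funext t; push_cast; ring
  have hrest : ‖demod n (fun t => ((e t ω - clip M (e t ω) + a M : ℝ) : ℂ)) θ‖
      ≤ ε / 4 + ε / 8 := by
    refine (norm_demod_le_sum_div _ _ _).trans ?_
    have h6 : ∑ t ∈ Finset.Icc 1 n, ‖((e t ω - clip M (e t ω) + a M : ℝ) : ℂ)‖
        ≤ ∑ t ∈ Finset.Icc 1 n, (|e t ω - clip M (e t ω)| + |a M|) :=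
      Finset.sum_le_sum fun t _ => by rw [Complex.norm_real]; exact abs_add_le _ _
    calc _ ≤ (∑ t ∈ Finset.Icc 1 n, (|e t ω - clip M (e t ω)| + |a M|)) / n := by gcongr
      _ = (∑ i ∈ Finset.range n, |e (i + 1) ω - clip M (e (i + 1) ω)|) / n + |a M| := by
          rw [sum_Icc_one_eq_sum_range, Finset.sum_add_distrib, add_div]
          simp [hn0]
      _ ≤ ε / 4 + ε / 8 := add_le_add h4.le ((haτ M).trans hM.le)
  rw [hsplit, demod_add]
  refine (norm_add_le _ _).trans ?_
  linarith

end Noise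

/-! ### Consistency of one step -/

section Step

variable {p : ℕ} {Θ : Set (ℝ × ℝ)} {η₀ : Fin p → ChirpParam} {c : Fin p → ℂ} {k : Fin p}
  {w : ℕ → ℕ → ℂ} {θ : ℕ → ℝ × ℝ}

/-- Maximizers of the periodogram converge fast to the frequency pair of a component that dominates
the other contributions. -/
theorem tendsto_chirpDist_of_isMaxOn (hΘ : IsFrequencySpace Θ)
    (hres : IsNonresonant fun k => (η₀ k).2) (hck : c k ≠ 0)
    (hw : IsNegligibleOn (Set.Ioo 0 Real.pi ×ˢ Set.Ioo 0 Real.pi) w) {z : ℕ → ℕ → ℝ}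
    (hz : ∀ᶠ n in atTop, ∀ t,
      (z n t : ℂ) = chirpSum (pairCoeff c) (pairFreq fun k => (η₀ k).2) t + w n t)
    {N : Set (ℝ × ℝ)} (hNΘ : N ⊆ Θ) (hkN : (η₀ k).2 ∈ N)
    (hθ : ∀ᶠ n in atTop, θ n ∈ N ∧ IsMaxOn (periodogram n (z n)) N (θ n))
    (hdom : ∀ a, a ≠ (k, true) → ∃ m < ‖c k‖, ∀ᶠ n in atTop,
      ‖c a.1‖ * ‖chirpMean n (pairFreq (fun k => (η₀ k).2) a - θ n)‖ ≤ m) :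
    Tendsto (fun n => chirpDist n (η₀ k).2 (θ n)) atTop (𝓝 0) := by
  have hθU : ∀ᶠ n in atTop, θ n ∈ Set.Ioo 0 Real.pi ×ˢ Set.Ioo 0 Real.pi :=
    hθ.mono fun n hn => hΘ.subset (hNΘ hn.1)
  have hkU := hΘ.subset (hNΘ hkN)
  refine tendsto_chirpDist_of_norm_chirpMean hkU hθU fun κ hκ => ?_
  refine eventually_le_norm_chirpMean_of_le_norm_demod (C := pairCoeff c)
    (F := pairFreq fun k => (η₀ k).2) (a₀ := (k, true)) hres.pairFreq_sub hw hck hkU hθU ?_ ?_ hκ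
  · filter_upwards [hz, hθ, eventually_ge_atTop 1] with n h1 h2 h3
    have := norm_demod_le_of_isMaxOn h3 h2.2 hkN
    simp only [h1] at this
    exact this
  · intro a ha
    simpa only [norm_pairCoeff] using hdom a ha

/-- Other components, and their conjugates, lose by their smaller coefficients. The conjugate of `k`
has the same modulus and loses only through its mean, which identifiability keeps below one. -/
theorem exists_dominated_of_norm_lt (hΘ : IsFrequencySpace Θ)
    (hint : (η₀ k).2 ∈ interior Θ) (hres : IsNonresonant fun k => (η₀ k).2) (hck : c k ≠ 0)
    (hlt : ∀ j, j ≠ k → ‖c j‖ < ‖c k‖) (hθ : ∀ᶠ n in atTop, θ n ∈ Θ)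
    (a : Fin p × Bool) (ha : a ≠ (k, true)) : ∃ m < ‖c k‖, ∀ᶠ n in atTop,
      ‖c a.1‖ * ‖chirpMean n (pairFreq (fun k => (η₀ k).2) a - θ n)‖ ≤ m := by
  obtain ⟨j, s⟩ := a
  by_cases hj : j = k
  · subst hj
    have hs : s = false := by
      cases s
      · rfl
      · exact absurd rfl ha
    subst hs
    obtain ⟨m, hm, hm'⟩ := exists_forall_norm_chirpMean_conj_le hΘ hint (hres.add j j)
    have hpos : 0 < ‖c j‖ := norm_pos_iff.2 hck
    refine ⟨‖c j‖ * m, by nlinarith, ?_⟩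
    filter_upwards [hm', hθ] with n h1 h2
    exact mul_le_mul_of_nonneg_left (h1 _ h2) hpos.le
  · exact ⟨‖c j‖, hlt j hj, Eventually.of_forall fun n =>
      mul_le_of_le_one_right (norm_nonneg _) (norm_chirpMean_le_one _ _)⟩

/-- Near `θₖ` the other signed pairs differ from `θ` by nearly a nonexceptional pair, so their means
are as small as desired, whatever the amplitudes. This is why local search needs no ordering. -/
theorem exists_radius_dominated (hres : IsNonresonant fun k => (η₀ k).2) (hc : ∀ k, c k ≠ 0) :
    ∃ r > 0, ∀ k, ∀ a, a ≠ (k, true) → ∃ m < ‖c k‖, ∀ᶠ n in atTop,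
      ∀ θ ∈ Metric.ball (η₀ k).2 r,
        ‖c a.1‖ * ‖chirpMean n (pairFreq (fun k => (η₀ k).2) a - θ)‖ ≤ m := by
  have hev : ∀ᶠ r in 𝓝[>] (0 : ℝ), ∀ k, ∀ a, a ≠ (k, true) → ∃ m < ‖c k‖, ∀ᶠ n in atTop,
      ∀ θ ∈ Metric.ball (η₀ k).2 r,
        ‖c a.1‖ * ‖chirpMean n (pairFreq (fun k => (η₀ k).2) a - θ)‖ ≤ m := by
    simp only [eventually_all]
    intro k a ha
    have hpos : 0 < ‖c k‖ := norm_pos_iff.2 (hc k)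
    have hpos' : 0 < ‖c a.1‖ := norm_pos_iff.2 (hc a.1)
    obtain ⟨r, hr, N, hN⟩ := exists_forall_dist_lt_norm_chirpMean_le
      (hres.pairFreq_sub a (k, true) ha) (show 0 < ‖c k‖ / 2 / ‖c a.1‖ by positivity)
    filter_upwards [nhdsWithin_le_nhds (eventually_le_nhds hr)] with r' hr'
    refine ⟨‖c k‖ / 2, by linarith, ?_⟩
    filter_upwards [eventually_ge_atTop N] with n hn θ hθ
    have h1 := hN n hn (pairFreq (fun k => (η₀ k).2) a - θ) (by
      have h2 : pairFreq (fun k => (η₀ k).2) (k, true) = (η₀ k).2 := rfl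
      rw [h2, dist_sub_left]
      exact lt_of_lt_of_le hθ hr')
    calc _ ≤ ‖c a.1‖ * (‖c k‖ / 2 / ‖c a.1‖) := by gcongr
      _ = ‖c k‖ / 2 := by field_simp
  obtain ⟨r, h, hr⟩ := (hev.and self_mem_nhdsWithin).exists
  exact ⟨r, hr, h⟩

end Step

/-! ### Consistency of the estimators along a sequence of observations -/

section Pathwise

variable {Ω : Type*} {p : ℕ} {Θ : Set (ℝ × ℝ)} {η₀ : Fin p → ChirpParam}
  {e : ℕ → Ω → ℝ} {ω : Ω} {ηn : ℕ → Fin p → ChirpParam}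

theorem chirpData_eq_chirpSum (η₀ : Fin p → ChirpParam) (e : ℕ → Ω → ℝ) (ω : Ω) (t : ℕ) :
    (chirpData η₀ e ω t : ℂ) = chirpSum (pairCoeff fun k => chirpCoeff (η₀ k))
      (pairFreq fun k => (η₀ k).2) t + (e t ω : ℂ) := by
  rw [chirpSum_pair, chirpData, Complex.ofReal_add, Complex.ofReal_sum]
  simp only [chirp_eq_coeff]

/-- Earlier components get coefficient zero, and their imperfect removal joins the noise as a
perturbation. -/
theorem chirpResidual_eq_chirpSum (η₀ η : Fin p → ChirpParam) (e : ℕ → Ω → ℝ) (ω : Ω)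
    (k : Fin p) (t : ℕ) :
    (chirpResidual (chirpData η₀ e ω) η k t : ℂ)
      = chirpSum (pairCoeff fun j => if j < k then 0 else chirpCoeff (η₀ j))
          (pairFreq fun k => (η₀ k).2) t
        + ((e t ω : ℂ)
          + ∑ j ∈ Finset.Iio k, ((chirp (η₀ j) t - chirp (η j) t : ℝ) : ℂ)) := by
  have h1 : ∑ j, chirp (η₀ j) t
      = ∑ j, (if j < k then 0 else chirp (η₀ j) t) + ∑ j ∈ Finset.Iio k, chirp (η₀ j) t := by
    have h2 : Finset.Iio k = Finset.univ.filter (· < k) := by ext; simp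
    rw [h2, Finset.sum_filter, ← Finset.sum_add_distrib]
    exact Finset.sum_congr rfl fun j _ => by split_ifs <;> simp
  have h3 : chirpSum (pairCoeff fun j => if j < k then 0 else chirpCoeff (η₀ j))
      (pairFreq fun k => (η₀ k).2) t = ((∑ j, if j < k then 0 else chirp (η₀ j) t : ℝ) : ℂ) := by
    rw [chirpSum_pair, Complex.ofReal_sum]
    refine Finset.sum_congr rfl fun j _ => ?_
    split_ifs
    · simp
    · rw [chirp_eq_coeff]
  rw [h3, chirpResidual, chirpData, h1]
  push_cast
  rw [Finset.sum_sub_distrib]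
  ring

theorem norm_chirpCoeff_lt {η η' : ChirpParam} (h : chirpPower η < chirpPower η') :
    ‖chirpCoeff η‖ < ‖chirpCoeff η'‖ := by
  refine lt_of_pow_lt_pow_left₀ 2 (norm_nonneg _) ?_
  rw [norm_chirpCoeff_sq, norm_chirpCoeff_sq]
  linarith

theorem chirpCoeff_ne_zero {η : ChirpParam} (h : 0 < chirpPower η) : chirpCoeff η ≠ 0 := by
  intro h0
  have := norm_chirpCoeff_sq η
  rw [h0, norm_zero] at this
  linarith

/-- The amplitude estimates converge if the frequency pairs converge fast. -/
theorem tendsto_amplitudes_of_tendsto_chirpDist (hres : IsNonresonant fun k => (η₀ k).2)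
    (hnoise : IsNegligibleOn (Set.Ioo 0 Real.pi ×ˢ Set.Ioo 0 Real.pi) fun _ t => (e t ω : ℂ))
    {k : Fin p} (hU : ∀ᶠ n in atTop, (ηn n k).2 ∈ Set.Ioo 0 Real.pi ×ˢ Set.Ioo 0 Real.pi)
    (hamp : ∀ᶠ n in atTop, (ηn n k).1 = amplitudeEstimate n (chirpData η₀ e ω) (ηn n k).2)
    (hdist : Tendsto (fun n => chirpDist n (η₀ k).2 (ηn n k).2) atTop (𝓝 0)) :
    Tendsto (fun n => (ηn n k).1) atTop (𝓝 (η₀ k).1) := by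
  have h := tendsto_demod_of_tendsto_chirpDist (C := pairCoeff fun k => chirpCoeff (η₀ k))
    (F := pairFreq fun k => (η₀ k).2) (a₀ := (k, true)) (θ := fun n => (ηn n k).2)
    hres.pairFreq_sub hnoise hU hdist
  simp only [← chirpData_eq_chirpSum] at h
  exact (tendsto_amplitudeEstimate h).congr' (hamp.mono fun n hn => hn.symm)

/-- Strong induction on the step. The induction carries `chirpDist → 0` because the removal of
earlier components requires this rate; then `k` has the largest remaining coefficient. -/
theorem tendsto_of_isSequentialALSE (hΘ : IsFrequencySpace Θ)
    (hint : ∀ k, (η₀ k).2 ∈ interior Θ) (hres : IsNonresonant fun k => (η₀ k).2)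
    (hamp : StrictAnti fun k => chirpPower (η₀ k)) (hpos : ∀ k, 0 < chirpPower (η₀ k))
    (hnoise : IsNegligibleOn (Set.Ioo 0 Real.pi ×ˢ Set.Ioo 0 Real.pi) fun _ t => (e t ω : ℂ))
    (h : ∀ᶠ n in atTop, IsSequentialALSE Θ n (chirpData η₀ e ω) (ηn n)) (k : Fin p) :
    Tendsto (fun n => (ηn n k).1) atTop (𝓝 (η₀ k).1) ∧
      Tendsto (fun n => chirpDist n (η₀ k).2 (ηn n k).2) atTop (𝓝 0) := by
  induction k using WellFoundedLT.induction with
  | ind k ih =>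
    have hmem : ∀ᶠ n in atTop, (ηn n k).2 ∈ Θ := h.mono fun n hn => (hn k).1
    have hw : IsNegligibleOn (Set.Ioo 0 Real.pi ×ˢ Set.Ioo 0 Real.pi) fun n t => (e t ω : ℂ)
        + ∑ j ∈ Finset.Iio k, ((chirp (η₀ j) t - chirp (ηn n j) t : ℝ) : ℂ) :=
      hnoise.add (IsNegligibleOn.sum _ fun j hj =>
        isNegligibleOn_chirp_sub (ih j (Finset.mem_Iio.1 hj)).1 (ih j (Finset.mem_Iio.1 hj)).2)
    have hck : (if k < k then 0 else chirpCoeff (η₀ k)) ≠ 0 := by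
      rw [if_neg (lt_irrefl k)]
      exact chirpCoeff_ne_zero (hpos k)
    have hlt : ∀ j, j ≠ k → ‖if j < k then 0 else chirpCoeff (η₀ j)‖
        < ‖if k < k then 0 else chirpCoeff (η₀ k)‖ := by
      intro j hj
      split_ifs with h1
      · exact absurd ‹k < k› (lt_irrefl k)
      · rw [norm_zero]
        exact norm_pos_iff.2 (chirpCoeff_ne_zero (hpos k))
      · exact absurd ‹k < k› (lt_irrefl k)
      · exact norm_chirpCoeff_lt (hamp (lt_of_le_of_ne (not_lt.1 h1) (Ne.symm hj)))
    have hdist := tendsto_chirpDist_of_isMaxOn (η₀ := η₀) hΘ hres hck hw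
      (z := fun n => chirpResidual (chirpData η₀ e ω) (ηn n) k) (θ := fun n => (ηn n k).2)
      (Eventually.of_forall fun n t => chirpResidual_eq_chirpSum _ _ _ _ _ _)
      subset_rfl (interior_subset (hint k))
      (h.mono fun n hn => ⟨(hn k).1, (hn k).2.1⟩)
      (exists_dominated_of_norm_lt (c := fun j => if j < k then 0 else chirpCoeff (η₀ j))
        hΘ (hint k) hres hck hlt hmem)
    exact ⟨tendsto_amplitudes_of_tendsto_chirpDist hres hnoise
      (hmem.mono fun n hn => hΘ.subset hn) (h.mono fun n hn => (hn k).2.2) hdist, hdist⟩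

end Pathwise

theorem theorem4p2 {Ω : Type*} [MeasurableSpace Ω] (P : Measure Ω) [IsProbabilityMeasure P]
    (e : ℕ → Ω → ℝ) (δ : ℝ) (he : IsErrorProcess P δ e)
    (p : ℕ) (Θ : Set (ℝ × ℝ)) (hΘ : IsFrequencySpace Θ)
    (η₀ : Fin p → ChirpParam)
    (hint : ∀ k, (η₀ k).2 ∈ interior Θ)
    (hres : IsNonresonant (fun k => (η₀ k).2))
    (hamp : StrictAnti (fun k => chirpPower (η₀ k)))
    (hpos : ∀ k, 0 < chirpPower (η₀ k)) :
    -- stepwise maximization over the whole parameter space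
    (∀ ηn : ℕ → Ω → Fin p → ChirpParam,
      (∀ᵐ ω ∂P, ∀ᶠ n in atTop, IsSequentialALSE Θ n (chirpData η₀ e ω) (ηn n ω)) →
      ∀ j, IsStronglyConsistent P (fun n ω => ηn n ω j) (η₀ j)) ∧
    -- the first step over any search region in the parameter space, the later ones local
    (∃ r > 0, ∀ N : Fin p → Set (ℝ × ℝ),
      (∀ k, N k ⊆ Θ ∧ N k ∈ 𝓝 (η₀ k).2) →
      (∀ k : Fin p, (k : ℕ) ≠ 0 → N k ⊆ Metric.ball (η₀ k).2 r) →
      ∀ ηn : ℕ → Ω → Fin p → ChirpParam,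
        (∀ᵐ ω ∂P, ∀ᶠ n in atTop, IsLocalALSE N n (chirpData η₀ e ω) (ηn n ω)) →
        ∀ j, IsStronglyConsistent P (fun n ω => ηn n ω j) (η₀ j)) := by
  have hc : ∀ k, chirpCoeff (η₀ k) ≠ 0 := fun k => chirpCoeff_ne_zero (hpos k)
  refine ⟨fun ηn h j => ?_, ?_⟩
  · filter_upwards [he.ae_isNegligibleOn, h] with ω hnoise hω
    obtain ⟨h1, h2⟩ := tendsto_of_isSequentialALSE hΘ hint hres hamp hpos hnoise hω j
    exact h1.prodMk_nhds (tendsto_of_tendsto_chirpDist h2)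
  · obtain ⟨r, hr, hdom⟩ := exists_radius_dominated hres hc
    refine ⟨r, hr, fun N hN hball ηn h j => ?_⟩
    filter_upwards [he.ae_isNegligibleOn, h] with ω hnoise hω
    have hmem : ∀ᶠ n in atTop, (ηn n ω j).2 ∈ Θ := hω.mono fun n hn => (hN j).1 (hn j).1
    have hdist := tendsto_chirpDist_of_isMaxOn (c := fun k => chirpCoeff (η₀ k))
      hΘ hres (hc j) hnoise (z := fun _ => chirpData η₀ e ω) (θ := fun n => (ηn n ω j).2)
      (Eventually.of_forall fun n t => chirpData_eq_chirpSum _ _ _ _)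
      (hN j).1 (mem_of_mem_nhds (hN j).2) (hω.mono fun n hn => ⟨(hn j).1, (hn j).2.1⟩) (by
        -- In the first step, over an arbitrary region, the ordering of the amplitudes makes the
        -- component dominate; in later steps the small radius does.
        by_cases hj : (j : ℕ) = 0
        · refine exists_dominated_of_norm_lt (c := fun k => chirpCoeff (η₀ k)) hΘ (hint j) hres
            (hc j) (fun i hi => ?_) hmem
          refine norm_chirpCoeff_lt (hamp (lt_of_le_of_ne ?_ (Ne.symm hi)))
          rw [Fin.le_def, hj]
          exact Nat.zero_le _
        · intro a ha
          obtain ⟨m, hm, hm'⟩ := hdom j a ha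
          refine ⟨m, hm, ?_⟩
          filter_upwards [hm', hω] with n h1 h2
          exact h1 _ (hball j hj (h2 j).1))
    exact (tendsto_amplitudes_of_tendsto_chirpDist (ηn := fun n => ηn n ω) hres hnoise
      (hmem.mono fun n hn => hΘ.subset hn) (hω.mono fun n hn => (hn j).2.2)
      hdist).prodMk_nhds (tendsto_of_tendsto_chirpDist hdist)
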